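/- Let $q$ be a prime power, $\Lambda=\mathbb F_q[X]$ and $F=\mathbb F_q((X^{-1}))$, with the absolute value $|0|=0$, $|f|=e^{\ell_0}$ for $f=\sum_{\ell\le \ell_0}\alpha_\ell X^\ell$, $\alpha_{\ell_0}\neq 0$. Let $m,n\ge 1$, and equip $F^m$, $F^n$ and $F^{m\times n}$ with the supremum norm. **Exponents.** For $Y\in F^{m\times n}$ and $\boldsymbol\theta\in F^m$ let $\omega(Y,\boldsymbol\theta)\in[0,\infty]$ be the supremum of the reals $\omega\ge 0$ such that, for arbitrarily large $T\ge 1$, there are $\mathbf p\in\Lambda^m$ and $\mathbf q\in\Lambda^n\setminus\{0\}$ with $$\|Y\mathbf q+\mathbf p+\boldsymbol\theta\|^m<e^{-\omega T}\quad\text{and}\quad \|\mathbf q\|^n<e^T .$$ Let $\omega^\times(Y,\boldsymbol\theta)\in[0,\infty]$ be defined in the same way with the inequalities $$\prod_{i=1}^m|(Y\mathbf q+\mathbf p+\boldsymbol\theta)_i|<e^{-\omega T}\quad\text{and}\quad \prod_{j=1}^n\max\{1,|q_j|\}<e^T .$$ A Borel measure $\mu$ on $F^{m\times n}$ is *extremal*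 (*strongly extremal*) if $\omega(Y,\mathbf 0)=1$ ($\omega^\times(Y,\mathbf 0)=1$) for $\mu$-almost every $Y$. It is *inhomogeneously extremal* (*inhomogeneously strongly extremal*) if for every $\boldsymbol\theta\in F^m$ one has $\omega(Y,\boldsymbol\theta)=1$ ($\omega^\times(Y,\boldsymbol\theta)=1$) for $\mu$-almost every $Y$. **Contracting measures.** For $\mathbf b\in F^n$ with $\|\mathbf b\|=1$, $\mathbf c\in F^m$ and $\boldsymbol\varepsilon\in(0,\infty)^m$ put $\mathcal L^{(\boldsymbol\varepsilon)}_{\mathbf b,\mathbf c}=\{Y\in F^{m\times n}: |Y_i\mathbf b+c_i|<\varepsilon_i,\ i=1,\dots,m\}$, where $Y_i$ is the $i$-th row of $Y$. For a ball $B$ of radius $r$ and $a>0$, $aB$ is the ball with the same centre and radius $ar$. A Borel measure $\mu$ on $F^{m\times n}$ with support $S$ is *strongly contracting* if it is finite, non-atomic (points have measure $0$) and doubling (there is $c>0$ with $\mu(2B)\le c\,\mu(B)$ for every ball $B$ centred in $S$), and there are $C,\alpha,r_0>0$ such that for all $\mathbf b,\mathbf c$ as above, all $\boldsymbol\varepsilon\in(0,\infty)^m$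 with $\min_j\varepsilon_j<r_0$, all $0<\delta<1$ and all $Y\in\mathcal L^{(\delta\boldsymbol\varepsilon)}_{\mathbf b,\mathbf c}\cap S$ there is an open ball $B$ centred at $Y$ with $$B\cap S\subset\mathcal L^{(\boldsymbol\varepsilon)}_{\mathbf b,\mathbf c}\quad\text{and}\quad \mu\big(5B\cap\mathcal L^{(\delta\boldsymbol\varepsilon)}_{\mathbf b,\mathbf c}\big)\le C\delta^\alpha\mu(5B).$$ It is *contracting* if the same holds with the $\boldsymbol\varepsilon$ restricted to $\varepsilon_1=\dots=\varepsilon_m$. It is (strongly) contracting *almost everywhere* if $\mu$-almost every point has a (Borel) neighbourhood $V$ such that the restriction $\mu|_V$ is (strongly) contracting. **Theorem.** Let $\mu$ be a Borel measure on $F^{m\times n}$. (A) If $\mu$ is contracting almost everywhere, then $\mu$ is extremal if and only if it is inhomogeneously extremal. (B) If $\mu$ is strongly contracting almost everywhere, then $\mu$ is strongly extremal if and only if it is inhomogeneously strongly extremal. -/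

import Mathlib

open MeasureTheory Topology Polynomial

namespace FunctionFieldDA

/-- The field `F = K((X⁻¹))` of Laurent series in `X⁻¹` over `K`. The coefficient of index `k` of
the underlying Hahn series is the coefficient of `(X⁻¹)^k = X^(-k)`. This is a type synonym, so that
it carries only the absolute value defined below. -/
def LaurentInv (K : Type*) [Field K] : Type _ := LaurentSeries K

variable {K : Type*} [Field K]

noncomputable instance : Field (LaurentInv K) := inferInstanceAs (Field (LaurentSeries K))

/-- The series underlying an element of `K((X⁻¹))`, in powers of `X⁻¹`. -/
def LaurentInv.toSeries (f : LaurentInv K) : LaurentSeries K := f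

open Classical in
/-- `|0| = 0`, and `|f| = e^ℓ₀` if `X^ℓ₀` is the largest power of `X` that occurs in `f ≠ 0`,
that is, if `-ℓ₀` is the order of `f` as a series in `X⁻¹`. -/
noncomputable instance : Norm (LaurentInv K) :=
  ⟨fun f => if f = 0 then 0 else Real.exp (-(f.toSeries.order : ℝ))⟩

theorem LaurentInv.norm_zero_eq : ‖(0 : LaurentInv K)‖ = 0 := if_pos rfl

theorem LaurentInv.norm_of_ne {f : LaurentInv K} (hf : f ≠ 0) :
    ‖f‖ = Real.exp (-(f.toSeries.order : ℝ)) := if_neg hf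

theorem LaurentInv.norm_nonneg' (f : LaurentInv K) : 0 ≤ ‖f‖ := by
  by_cases hf : f = 0
  · rw [hf, norm_zero_eq]
  · rw [norm_of_ne hf]; exact (Real.exp_pos _).le

theorem LaurentInv.norm_neg_eq (f : LaurentInv K) : ‖-f‖ = ‖f‖ := by
  by_cases hf : f = 0
  · rw [hf, neg_zero]
  · rw [norm_of_ne hf, norm_of_ne (neg_ne_zero.mpr hf)]
    have : (-f).toSeries.order = f.toSeries.order := HahnSeries.order_neg (f := f.toSeries)
    rw [this]

theorem LaurentInv.norm_mul_eq (f g : LaurentInv K) : ‖f * g‖ = ‖f‖ * ‖g‖ := by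
  by_cases hf : f = 0
  · rw [hf, zero_mul, norm_zero_eq, zero_mul]
  by_cases hg : g = 0
  · rw [hg, mul_zero, norm_zero_eq, mul_zero]
  rw [norm_of_ne hf, norm_of_ne hg, norm_of_ne (mul_ne_zero hf hg), ← Real.exp_add]
  have : (f * g).toSeries.order = f.toSeries.order + g.toSeries.order :=
    HahnSeries.order_mul (x := f.toSeries) (y := g.toSeries) hf hg
  rw [this]; push_cast; ring_nf

/-- The ultrametric inequality. -/
theorem LaurentInv.norm_add_le_max' (f g : LaurentInv K) : ‖f + g‖ ≤ max ‖f‖ ‖g‖ := by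
  by_cases hf : f = 0
  · rw [hf, zero_add]; exact le_max_right _ _
  by_cases hg : g = 0
  · rw [hg, add_zero]; exact le_max_left _ _
  by_cases h : f + g = 0
  · rw [h, norm_zero_eq]; exact le_max_of_le_left (norm_nonneg' f)
  have key : min f.toSeries.order g.toSeries.order ≤ (f + g).toSeries.order :=
    HahnSeries.min_order_le_order_add (x := f.toSeries) (y := g.toSeries) h
  rw [norm_of_ne hf, norm_of_ne hg, norm_of_ne h]
  rcases min_le_iff.mp key with h' | h'
  · refine le_max_of_le_left (Real.exp_le_exp.mpr (neg_le_neg ?_)); exact_mod_cast h'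
  · refine le_max_of_le_right (Real.exp_le_exp.mpr (neg_le_neg ?_)); exact_mod_cast h'

/-- `K((X⁻¹))` as a normed field, with the metric `|f - g|`. -/
noncomputable instance : NormedField (LaurentInv K) where
  dist f g := ‖-f + g‖
  dist_self f := by
    rw [neg_add_cancel, LaurentInv.norm_zero_eq]
  dist_comm f g := by
    rw [← LaurentInv.norm_neg_eq (-f + g)]; congr 1; ring
  dist_triangle f g h := by
    have e : -f + h = (-f + g) + (-g + h) := by ring
    rw [e]
    exact (LaurentInv.norm_add_le_max' _ _).trans
      (max_le_add_of_nonneg (LaurentInv.norm_nonneg' _) (LaurentInv.norm_nonneg' _))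
  eq_of_dist_eq_zero := by
    intro f g h
    change ‖-f + g‖ = 0 at h
    by_contra hne
    have h0 : -f + g ≠ 0 := fun h0 => hne (by linear_combination -h0)
    rw [LaurentInv.norm_of_ne h0] at h
    exact (Real.exp_pos _).ne' h
  dist_eq _ _ := rfl
  norm_mul := LaurentInv.norm_mul_eq

/-- The inclusion of the constants `K` into `F`. -/
noncomputable def constIncl : K →+* LaurentInv K := (HahnSeries.C : K →+* LaurentSeries K)

/-- The element `X = (X⁻¹)^(-1)` of `F`. -/
noncomputable def LaurentInv.X : LaurentInv K :=
  (HahnSeries.single (-1 : ℤ) (1 : K) : LaurentSeries K)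

/-- The inclusion of `Λ = K[X]` into `F = K((X⁻¹))`. -/
noncomputable def polyIncl : K[X] →+* LaurentInv K :=
  Polynomial.eval₂RingHom constIncl LaurentInv.X

/-- A vector of polynomials, as a vector over `F`. -/
noncomputable def polyVec {k : ℕ} (q : Fin k → K[X]) : Fin k → LaurentInv K :=
  fun i => polyIncl (q i)

/-- The space `F^{m × n}` of `m × n` matrices over `F`, with the supremum norm. -/
abbrev FMat (K : Type*) [Field K] (m n : ℕ) : Type _ := Fin m → Fin n → LaurentInv K

/-- `F^{m × n}` carries its Borel σ-algebra. -/
noncomputable instance (m n : ℕ) : MeasurableSpace (FMat K m n) := borel _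

noncomputable instance (m n : ℕ) : BorelSpace (FMat K m n) := ⟨rfl⟩

/-- The vector `Y b + c` of `F^m`; its `i`-th entry is `Y_i b + c_i`, with `Y_i` the `i`-th row. -/
noncomputable def affineForm {m n : ℕ} (Y : FMat K m n) (b : Fin n → LaurentInv K)
    (c : Fin m → LaurentInv K) : Fin m → LaurentInv K :=
  fun i => ∑ j, Y i j * b j + c i

/-! ### Exponents -/

/-- `ω(Y, θ)`: the supremum (possibly `⊤`) of the reals `ω ≥ 0` such that for arbitrarily large
`T ≥ 1` there are `p ∈ Λ^m` and `q ∈ Λ^n`, `q ≠ 0`, with `‖Yq + p + θ‖^m < e^{-ωT}` and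
`‖q‖^n < e^T`. -/
noncomputable def expo {m n : ℕ} (Y : FMat K m n) (θ : Fin m → LaurentInv K) : EReal :=
  sSup (Real.toEReal '' {w : ℝ | 0 ≤ w ∧ ∀ T₀ : ℝ, ∃ T : ℝ, T₀ ≤ T ∧ 1 ≤ T ∧
    ∃ (p : Fin m → K[X]) (q : Fin n → K[X]), q ≠ 0 ∧
      ‖affineForm Y (polyVec q) (polyVec p + θ)‖ ^ m < Real.exp (-w * T) ∧
      ‖polyVec q‖ ^ n < Real.exp T})

/-- `ω^×(Y, θ)`: as `ω(Y, θ)`, with the inequalities `∏ᵢ |(Yq + p + θ)ᵢ| < e^{-ωT}` and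
`∏ⱼ max {1, |qⱼ|} < e^T`. -/
noncomputable def mulExpo {m n : ℕ} (Y : FMat K m n) (θ : Fin m → LaurentInv K) : EReal :=
  sSup (Real.toEReal '' {w : ℝ | 0 ≤ w ∧ ∀ T₀ : ℝ, ∃ T : ℝ, T₀ ≤ T ∧ 1 ≤ T ∧
    ∃ (p : Fin m → K[X]) (q : Fin n → K[X]), q ≠ 0 ∧
      ∏ i, ‖affineForm Y (polyVec q) (polyVec p + θ) i‖ < Real.exp (-w * T) ∧
      ∏ j, max 1 ‖polyVec q j‖ < Real.exp T})

/-! ### Extremality -/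

/-- `ω(Y) = ω(Y, 0) = 1` for almost every `Y`. -/
def Extremal {m n : ℕ} (μ : Measure (FMat K m n)) : Prop :=
  ∀ᵐ Y ∂μ, expo Y 0 = 1

/-- `ω^×(Y) = ω^×(Y, 0) = 1` for almost every `Y`. -/
def StronglyExtremal {m n : ℕ} (μ : Measure (FMat K m n)) : Prop :=
  ∀ᵐ Y ∂μ, mulExpo Y 0 = 1

/-- For every `θ`, `ω(Y, θ) = 1` for almost every `Y`. -/
def InhomExtremal {m n : ℕ} (μ : Measure (FMat K m n)) : Prop :=
  ∀ θ : Fin m → LaurentInv K, ∀ᵐ Y ∂μ, expo Y θ = 1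

/-- For every `θ`, `ω^×(Y, θ) = 1` for almost every `Y`. -/
def InhomStronglyExtremal {m n : ℕ} (μ : Measure (FMat K m n)) : Prop :=
  ∀ θ : Fin m → LaurentInv K, ∀ᵐ Y ∂μ, mulExpo Y θ = 1

/-! ### Contracting measures -/

/-- `μ(2B) ≤ c μ(B)` for all balls `B` centred in the support of `μ`. -/
def IsDoubling {m n : ℕ} (μ : Measure (FMat K m n)) : Prop :=
  ∃ c : ℝ, 0 < c ∧ ∀ Y ∈ μ.support, ∀ r : ℝ, 0 < r →
    μ (Metric.ball Y (2 * r)) ≤ ENNReal.ofReal c * μ (Metric.ball Y r)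

/-- The `ε`-neighbourhood `{Y : |Y_i b + c_i| < ε_i for all i}` of the plane `Y b + c = 0`. -/
def planeNhd {m n : ℕ} (b : Fin n → LaurentInv K) (c : Fin m → LaurentInv K) (ε : Fin m → ℝ) :
    Set (FMat K m n) :=
  {Y | ∀ i, ‖affineForm Y b c i‖ < ε i}

/-- The contraction property of `μ` with constants `C, α` at the plane `Y b + c = 0`, for given
`ε` and `δ`: every `Y ∈ L^(δε) ∩ S`, with `S` the support of `μ`, is the centre of an open ball `B`
with `B ∩ S ⊆ L^(ε)` and `μ(5B ∩ L^(δε)) ≤ C δ^α μ(5B)`. -/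
def ContractsAt {m n : ℕ} (μ : Measure (FMat K m n)) (C α : ℝ) (b : Fin n → LaurentInv K)
    (c : Fin m → LaurentInv K) (ε : Fin m → ℝ) (δ : ℝ) : Prop :=
  ∀ Y ∈ planeNhd b c (fun i => δ * ε i) ∩ μ.support, ∃ r : ℝ, 0 < r ∧
    Metric.ball Y r ∩ μ.support ⊆ planeNhd b c ε ∧
    μ (Metric.ball Y (5 * r) ∩ planeNhd b c (fun i => δ * ε i)) ≤
      ENNReal.ofReal (C * δ ^ α) * μ (Metric.ball Y (5 * r))

/-- Strongly contracting measures: finite, non-atomic, doubling, with the contraction property for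
all `ε = (ε₁, …, ε_m)` with positive entries and `min ε_j < r₀`. -/
structure StronglyContracting {m n : ℕ} (μ : Measure (FMat K m n)) : Prop where
  finite : IsFiniteMeasure μ
  nonatomic : ∀ Y, μ {Y} = 0
  doubling : IsDoubling μ
  contracts : ∃ C α r₀ : ℝ, 0 < C ∧ 0 < α ∧ 0 < r₀ ∧
    ∀ (b : Fin n → LaurentInv K) (c : Fin m → LaurentInv K), ‖b‖ = 1 →
      ∀ ε : Fin m → ℝ, (∀ i, 0 < ε i) → (∃ i, ε i < r₀) →
        ∀ δ : ℝ, 0 < δ → δ < 1 → ContractsAt μ C α b c ε δ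

/-- Contracting measures: the same with `ε₁ = ⋯ = ε_m = ε`. -/
structure Contracting {m n : ℕ} (μ : Measure (FMat K m n)) : Prop where
  finite : IsFiniteMeasure μ
  nonatomic : ∀ Y, μ {Y} = 0
  doubling : IsDoubling μ
  contracts : ∃ C α r₀ : ℝ, 0 < C ∧ 0 < α ∧ 0 < r₀ ∧
    ∀ (b : Fin n → LaurentInv K) (c : Fin m → LaurentInv K), ‖b‖ = 1 →
      ∀ ε : ℝ, 0 < ε → ε < r₀ →
        ∀ δ : ℝ, 0 < δ → δ < 1 → ContractsAt μ C α b c (fun _ => ε) δ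

/-- Almost every point has a (Borel) neighbourhood `V` such that `μ|_V` is contracting. -/
def ContractingAE {m n : ℕ} (μ : Measure (FMat K m n)) : Prop :=
  ∀ᵐ Y₀ ∂μ, ∃ V ∈ 𝓝 Y₀, MeasurableSet V ∧ Contracting (μ.restrict V)

/-- Almost every point has a (Borel) neighbourhood `V` such that `μ|_V` is strongly contracting. -/
def StronglyContractingAE {m n : ℕ} (μ : Measure (FMat K m n)) : Prop :=
  ∀ᵐ Y₀ ∂μ, ∃ V ∈ 𝓝 Y₀, MeasurableSet V ∧ StronglyContracting (μ.restrict V)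

end FunctionFieldDA

/-! Taking `θ = 0` gives one implication, so only the passage from homogeneous to inhomogeneous
needs proof. The upper bound `ω(Y, θ) ≤ 1` is obtained almost everywhere by transference; the lower
bound is deterministic and holds at every `Y` with `ω(Y, 0) ≤ 1`.

Upper bound. If `ω(Y, θ) > 1`, then `Y` lies infinitely often in thin neighbourhoods `I` of planes
`Yq + p + θ = 0`. Each `I` sits in a wider neighbourhood `J` that still witnesses an exponent above
1. By subtraction and the ultrametric inequality, two such `J` of the same size meet only in a set
`H` of solutions of a homogeneous inequality, and the limsup of the `H` is null by assumption.
Contraction gives around each support point of `I` a ball whose trace on the support lies in `J`,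
with `I` of small proportion in the ball enlarged five times. Either at least half of the mass of
the ball lies off `H`: such pieces are disjoint for different planes, so these points have summable
measure and Borel–Cantelli applies. Or at least half lies in `H`: then a weak type bound for the
tails of the `H`, whose measure tends to 0, applies (`inhomogeneous_transference`). For `ω^×` the
approximations are first sorted by the orders of their coordinates, into polynomially many classes
against an exponential gain.

Lower bound. Multiplication by `X` shifts the digits of `Yq`. Hence the codimension of the digit
strings of length `M - A` reached by `q` of degree `< A` is a convex function of `A`
(`finrank_smallDigits_convex`). If positive, it grows by at least 1 with each step back, which
contradicts its value at a stage where no nonzero `q` is small (`truncDigits_surjective`). The bound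
`ω(Y, 0) ≤ 1` supplies such a stage, so the digits of `-θ` are reached at small cost. As `ω ≤ ω^×`,
this also bounds `ω^×` from below. -/

namespace FunctionFieldDA

/-! ### Inhomogeneous transference for doubling measures -/

section Transference

open Set Metric Filter
open scoped ENNReal

/-- Exhaustion of a set of centres of balls by subsets with bounded radii. -/
theorem measure_le_of_bounded_radii {X : Type*} [MeasurableSpace X] {μ : Measure X}
    {P : X → ℝ → Prop} {b : ℝ≥0∞}
    (h : ∀ R : ℕ, μ {x | ∃ r : ℝ, 0 < r ∧ r ≤ R ∧ P x r} ≤ b) : μ {x | ∃ r : ℝ, 0 < r ∧ P x r} ≤ b := by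
  have hU : {x | ∃ r : ℝ, 0 < r ∧ P x r} = ⋃ R : ℕ, {x | ∃ r : ℝ, 0 < r ∧ r ≤ R ∧ P x r} := by
    ext x
    simp only [mem_ofPred_eq, mem_iUnion]
    constructor
    · rintro ⟨r, h0, hP⟩
      obtain ⟨R, hR⟩ := exists_nat_ge r
      exact ⟨R, r, h0, hR, hP⟩
    · rintro ⟨R, r, h0, -, hP⟩
      exact ⟨r, h0, hP⟩
  have hmono : Monotone fun R : ℕ => {x | ∃ r : ℝ, 0 < r ∧ r ≤ (R : ℝ) ∧ P x r} := by
    rintro R R' hRR x ⟨r, h0, hle, hP⟩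
    exact ⟨r, h0, hle.trans (by exact_mod_cast hRR), hP⟩
  rw [hU, hmono.measure_iUnion]
  exact iSup_le h

/-- The tails decrease to the limsup, and finiteness gives continuity from above. -/
theorem tendsto_measure_tail_zero {X : Type*} [MeasurableSpace X] {μ : Measure X}
    [IsFiniteMeasure μ] {H : ℕ → Set X}
    (hH : ∀ N, MeasurableSet (H N)) (h0 : μ {x | ∃ᶠ N in atTop, x ∈ H N} = 0) :
    Tendsto (fun N => μ (⋃ M ≥ N, H M)) atTop (𝓝 0) := by
  have hm : ∀ N, NullMeasurableSet (⋃ M ≥ N, H M) μ := fun N =>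
    (MeasurableSet.biUnion (to_countable _) fun M _ => hH M).nullMeasurableSet
  have hanti : Antitone fun N => ⋃ M ≥ N, H M := fun N N' h =>
    biUnion_subset_biUnion_left fun M (hM : N' ≤ M) => h.trans hM
  have := tendsto_measure_iInter_atTop hm hanti ⟨0, measure_ne_top _ _⟩
  have e : (⋂ N, ⋃ M ≥ N, H M) = {x | ∃ᶠ N in atTop, x ∈ H N} := by
    ext x
    simp only [mem_iInter, mem_iUnion, mem_ofPred_eq, frequently_atTop, exists_prop]
  rwa [e, h0] at this

variable {X : Type*} [MetricSpace X] [SecondCountableTopology X]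

/-- A form of Vitali's covering lemma for open balls. -/
theorem exists_disjoint_balls (A : Set X) (r : X → ℝ) (R : ℝ) (hr : ∀ x ∈ A, 0 < r x)
    (hR : ∀ x ∈ A, r x ≤ R) :
    ∃ u ⊆ A, u.Countable ∧ u.PairwiseDisjoint (fun x => ball x (r x)) ∧
      A ⊆ ⋃ x ∈ u, ball x (5 * r x) := by
  obtain ⟨u, huA, hdisj, hcov⟩ :=
    Vitali.exists_disjoint_subfamily_covering_enlargement_closedBall A id r R hR 4 (by norm_num)
  have hd : u.PairwiseDisjoint (fun x => ball x (r x)) :=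
    hdisj.mono fun x => ball_subset_closedBall
  refine ⟨u, huA, ?_, hd, ?_⟩
  · exact hd.countable_of_isOpen (fun _ _ => isOpen_ball)
      (fun x hx => ⟨x, mem_ball_self (hr x (huA hx))⟩)
  · intro x hx
    obtain ⟨y, hy, hxy⟩ := hcov x hx
    have h1 : x ∈ closedBall y (4 * r y) := hxy (mem_closedBall_self (hr x hx).le)
    have h2 := hr y (huA hy)
    rw [mem_closedBall] at h1
    exact mem_biUnion hy (mem_ball.mpr (by linarith))

variable [MeasurableSpace X] [BorelSpace X] {μ : Measure X}

/-- The weak type bound: centres of balls with a positive proportion of their mass in `U`. -/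
theorem measure_dense_centres_le {D : ℝ≥0∞}
    (hD : ∀ x ∈ μ.support, ∀ r : ℝ, 0 < r → μ (ball x (5 * r)) ≤ D * μ (ball x r))
    {U : Set X} (hU : MeasurableSet U) :
    μ {x | ∃ r : ℝ, 0 < r ∧ x ∈ μ.support ∧ μ (ball x r) ≤ 2 * μ (ball x r ∩ U)} ≤ 2 * D * μ U := by
  -- Vitali's lemma needs bounded radii.
  apply measure_le_of_bounded_radii
  intro R
  set A := {x | ∃ r : ℝ, 0 < r ∧ r ≤ (R : ℝ) ∧ x ∈ μ.support ∧ μ (ball x r) ≤ 2 * μ (ball x r ∩ U)}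
    with hA
  have hex : ∀ x, ∃ r : ℝ, x ∈ A → 0 < r ∧ r ≤ (R : ℝ) ∧ x ∈ μ.support ∧
      μ (ball x r) ≤ 2 * μ (ball x r ∩ U) := by
    intro x
    by_cases hx : x ∈ A
    · obtain ⟨r, hr⟩ := hx
      exact ⟨r, fun _ => hr⟩
    · exact ⟨0, fun h => absurd h hx⟩
  choose r hr using hex
  obtain ⟨u, huA, hu, hdisj, hcov⟩ := exists_disjoint_balls A r R (fun x hx => (hr x hx).1)
    (fun x hx => (hr x hx).2.1)
  have := hu.to_subtype
  calc μ A ≤ μ (⋃ x ∈ u, ball x (5 * r x)) := measure_mono hcov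
    _ ≤ ∑' x : u, μ (ball x.1 (5 * r x)) := measure_biUnion_le μ hu _
    _ ≤ ∑' x : u, 2 * D * μ (ball x.1 (r x) ∩ U) := by
        refine ENNReal.tsum_le_tsum fun x => ?_
        obtain ⟨h0, -, hs, hh⟩ := hr x (huA x.2)
        calc μ (ball x.1 (5 * r x)) ≤ D * μ (ball x.1 (r x)) := hD _ hs _ h0
          _ ≤ D * (2 * μ (ball x.1 (r x) ∩ U)) := by gcongr
          _ = _ := by ring
    _ = 2 * D * μ (⋃ x ∈ u, ball x (r x) ∩ U) := by
        rw [ENNReal.tsum_mul_left, measure_biUnion hu]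
        · exact hdisj.mono fun x => inter_subset_left
        · exact fun x _ => measurableSet_ball.inter hU
    _ ≤ 2 * D * μ U := by
        gcongr
        exact iUnion₂_subset fun x _ => inter_subset_right

/-- The bound for centres of balls that lie, up to their intersections inside `U`, in disjoint
sets `J a`, and in which `I a` has small proportion. -/
theorem measure_sparse_centres_le {A : Type*} [Countable A] {D k : ℝ≥0∞}
    (hD : ∀ x ∈ μ.support, ∀ r : ℝ, 0 < r → μ (ball x (5 * r)) ≤ D * μ (ball x r))
    {U : Set X} (hU : MeasurableSet U) (I J : A → Set X)
    (hJ : ∀ a a', a ≠ a' → J a ∩ J a' ⊆ U) :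
    μ {x | ∃ r : ℝ, 0 < r ∧ ∃ a, x ∈ I a ∩ μ.support ∧ ball x r ∩ μ.support ⊆ J a ∧
      μ (ball x (5 * r) ∩ I a) ≤ k * μ (ball x (5 * r)) ∧
      μ (ball x r) ≤ 2 * μ (ball x r \ U)} ≤ 2 * D * k * μ univ := by
  apply measure_le_of_bounded_radii
  intro R
  set G : A → Set X := fun a => {x | ∃ r : ℝ, 0 < r ∧ r ≤ (R : ℝ) ∧ x ∈ I a ∩ μ.support ∧
      ball x r ∩ μ.support ⊆ J a ∧ μ (ball x (5 * r) ∩ I a) ≤ k * μ (ball x (5 * r)) ∧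
      μ (ball x r) ≤ 2 * μ (ball x r \ U)} with hG
  have hsub : {x | ∃ r : ℝ, 0 < r ∧ r ≤ (R : ℝ) ∧ ∃ a, x ∈ I a ∩ μ.support ∧
      ball x r ∩ μ.support ⊆ J a ∧ μ (ball x (5 * r) ∩ I a) ≤ k * μ (ball x (5 * r)) ∧
      μ (ball x r) ≤ 2 * μ (ball x r \ U)} ⊆ ⋃ a, G a := by
    rintro x ⟨r, h0, h1, a, h⟩
    exact mem_iUnion.mpr ⟨a, r, h0, h1, h⟩
  have hS : MeasurableSet μ.support := Measure.isClosed_support.measurableSet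
  have key : ∀ a, ∃ W : Set X, MeasurableSet W ∧ W ⊆ J a \ U ∧ μ (G a) ≤ 2 * D * k * μ W := by
    intro a
    have hex : ∀ x, ∃ r : ℝ, x ∈ G a → 0 < r ∧ r ≤ (R : ℝ) ∧ x ∈ I a ∩ μ.support ∧
      ball x r ∩ μ.support ⊆ J a ∧ μ (ball x (5 * r) ∩ I a) ≤ k * μ (ball x (5 * r)) ∧
      μ (ball x r) ≤ 2 * μ (ball x r \ U) := by
      intro x
      by_cases hx : x ∈ G a
      · obtain ⟨r, hr⟩ := hx
        exact ⟨r, fun _ => hr⟩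
      · exact ⟨0, fun h => absurd h hx⟩
    choose r hr using hex
    obtain ⟨u, huA, hu, hdisj, hcov⟩ := exists_disjoint_balls (G a) r R
      (fun x hx => (hr x hx).1) (fun x hx => (hr x hx).2.1)
    have hm : ∀ x ∈ u, MeasurableSet ((ball x (r x) ∩ μ.support) \ U) :=
      fun x _ => (measurableSet_ball.inter hS).diff hU
    -- Vitali makes these pieces disjoint for one `a`; lying in `J a \ U` makes them disjoint for
    -- different `a`. Hence only the mass off `U` is kept.
    refine ⟨⋃ x ∈ u, (ball x (r x) ∩ μ.support) \ U, MeasurableSet.biUnion hu hm, ?_, ?_⟩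
    · exact iUnion₂_subset fun x hx => sdiff_subset_sdiff_left (hr x (huA hx)).2.2.2.1
    calc μ (G a) ≤ μ (⋃ x ∈ u, ball x (5 * r x) ∩ I a) := by
          refine measure_mono fun x hx => ?_
          obtain ⟨y, hy, hxy⟩ := mem_iUnion₂.mp (hcov hx)
          exact mem_iUnion₂.mpr ⟨y, hy, hxy, (hr x hx).2.2.1.1⟩
      _ ≤ ∑' x : u, μ (ball x.1 (5 * r x) ∩ I a) := measure_biUnion_le μ hu _
      _ ≤ ∑' x : u, 2 * D * k * μ ((ball x.1 (r x) ∩ μ.support) \ U) := by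
          refine ENNReal.tsum_le_tsum fun x => ?_
          obtain ⟨h0, -, hs, -, hI, hh⟩ := hr x (huA x.2)
          have e : μ ((ball x.1 (r x) ∩ μ.support) \ U) = μ (ball x.1 (r x) \ U) := by
            rw [show (ball x.1 (r x) ∩ μ.support) \ U = (ball x.1 (r x) \ U) ∩ μ.support by
              ext; simp only [Set.mem_sdiff, mem_inter_iff]; tauto]
            exact measure_inter_conull Measure.measure_compl_support
          rw [e]
          calc _ ≤ k * μ (ball x.1 (5 * r x)) := hI
            _ ≤ k * (D * μ (ball x.1 (r x))) := by gcongr; exact hD _ hs.2 _ h0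
            _ ≤ k * (D * (2 * μ (ball x.1 (r x) \ U))) := by gcongr
            _ = _ := by ring
      _ = _ := by
          rw [ENNReal.tsum_mul_left, measure_biUnion hu _ hm]
          exact hdisj.mono fun x => sdiff_subset.trans inter_subset_left
  choose W hWm hWs hW using key
  calc _ ≤ μ (⋃ a, G a) := measure_mono hsub
    _ ≤ ∑' a, μ (G a) := measure_iUnion_le _
    _ ≤ ∑' a, 2 * D * k * μ (W a) := ENNReal.tsum_le_tsum hW
    _ = 2 * D * k * μ (⋃ a, W a) := by
        rw [ENNReal.tsum_mul_left, measure_iUnion _ hWm]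
        intro a a' haa
        refine disjoint_left.mpr fun x hx hx' => ?_
        exact (hWs a hx).2 (hJ a a' haa ⟨(hWs a hx).1, (hWs a' hx').1⟩)
    _ ≤ _ := by gcongr; exact subset_univ _

/-- The inhomogeneous transference principle for finite doubling measures: if the sets `I N j a`
contract inside the sets `J N j a`, which for fixed `N, j` meet only inside `H N`, and the limsup of
the `H N` is null, then so is the limsup of the `I N j a`. -/
theorem inhomogeneous_transference [IsFiniteMeasure μ] {A β : Type*} [Countable A] {D : ℝ≥0∞}
    (hDt : D ≠ ⊤)
    (hD : ∀ x ∈ μ.support, ∀ r : ℝ, 0 < r → μ (ball x (5 * r)) ≤ D * μ (ball x r))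
    (N₀ : ℕ) (B : ℕ → Finset β) (I J : ℕ → β → A → Set X) (H : ℕ → Set X) (k : ℕ → ℝ≥0∞)
    (hHm : ∀ N, MeasurableSet (H N))
    (hJ : ∀ N ≥ N₀, ∀ j ∈ B N, ∀ a a', a ≠ a' → J N j a ∩ J N j a' ⊆ H N)
    (hI : ∀ N ≥ N₀, ∀ j ∈ B N, ∀ a, ∀ x ∈ I N j a ∩ μ.support, ∃ r : ℝ, 0 < r ∧
      ball x r ∩ μ.support ⊆ J N j a ∧ μ (ball x (5 * r) ∩ I N j a) ≤ k N * μ (ball x (5 * r)))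
    (hk : ∑' N, (B N).card * k N ≠ ⊤) (hH : μ {x | ∃ᶠ N in atTop, x ∈ H N} = 0) :
    μ {x | ∃ᶠ N in atTop, ∃ j ∈ B N, ∃ a, x ∈ I N j a} = 0 := by
  set Good : ℕ → β → Set X := fun N j => {x | ∃ r : ℝ, 0 < r ∧ ∃ a, x ∈ I N j a ∩ μ.support ∧
      ball x r ∩ μ.support ⊆ J N j a ∧ μ (ball x (5 * r) ∩ I N j a) ≤ k N * μ (ball x (5 * r)) ∧
      μ (ball x r) ≤ 2 * μ (ball x r \ H N)}
  set Bad : Set X → Set X := fun U => {x | ∃ r : ℝ, 0 < r ∧ x ∈ μ.support ∧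
    μ (ball x r) ≤ 2 * μ (ball x r ∩ U)}
  have hgood : ∀ N ≥ N₀, ∀ j ∈ B N, μ (Good N j) ≤ 2 * D * k N * μ univ := fun N hN j hj =>
    measure_sparse_centres_le hD (hHm N) (I N j) (J N j) (hJ N hN j hj)
  set P : ℕ → X → Prop := fun N x => N₀ ≤ N ∧ ∃ j ∈ B N, x ∈ Good N j with hPdef
  have hP : μ {x | ∃ᶠ N in atTop, P N x} = 0 := by
    apply measure_setOfPred_frequently_eq_zero
    have hle : ∑' N, μ {x | P N x} ≤ ∑' N, 2 * D * μ univ * ((B N).card * k N) := by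
      refine ENNReal.tsum_le_tsum fun N => ?_
      by_cases hN : N₀ ≤ N
      · calc μ {x | P N x} ≤ μ (⋃ j ∈ B N, Good N j) := by
              refine measure_mono fun x hx => ?_
              obtain ⟨-, j, hj, hx⟩ := hx
              exact mem_iUnion₂.mpr ⟨j, hj, hx⟩
          _ ≤ ∑ j ∈ B N, μ (Good N j) := measure_biUnion_finset_le _ _
          _ ≤ ∑ j ∈ B N, 2 * D * k N * μ univ := Finset.sum_le_sum (hgood N hN)
          _ = _ := by rw [Finset.sum_const, nsmul_eq_mul]; ring
      · have : {x | P N x} = ∅ := by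
          ext x; simp [hPdef, hN]
        rw [this]; simp
    refine ne_top_of_le_ne_top ?_ hle
    rw [ENNReal.tsum_mul_left]
    exact ENNReal.mul_ne_top (by finiteness) hk
  have hU : ∀ N, MeasurableSet (⋃ M ≥ N, H M) := fun N =>
    MeasurableSet.biUnion (to_countable _) fun M _ => hHm M
  -- The measures of the `H N` need not be summable, so the weak type bound is applied to the tails.
  have hbad : μ (⋂ N, Bad (⋃ M ≥ N, H M)) = 0 := by
    have ht := tendsto_measure_tail_zero hHm hH
    have ht2 : Tendsto (fun N => 2 * D * μ (⋃ M ≥ N, H M)) atTop (𝓝 (2 * D * 0)) :=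
      ENNReal.Tendsto.const_mul ht (Or.inr (by finiteness))
    rw [mul_zero] at ht2
    refine le_antisymm (ge_of_tendsto' ht2 fun N => ?_) bot_le
    exact (measure_mono (iInter_subset _ N)).trans (measure_dense_centres_le hD (hU N))
  have hsub : {x | ∃ᶠ N in atTop, ∃ j ∈ B N, ∃ a, x ∈ I N j a} ⊆
      μ.supportᶜ ∪ ({x | ∃ᶠ N in atTop, P N x} ∪ ⋂ N, Bad (⋃ M ≥ N, H M)) := by
    intro x hx
    by_cases hs : x ∈ μ.support
    swap
    · exact Or.inl hs
    right
    by_cases hxP : ∃ᶠ N in atTop, P N x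
    · exact Or.inl hxP
    right
    rw [not_frequently] at hxP
    refine mem_iInter.mpr fun N => ?_
    obtain ⟨M, ⟨⟨j, hj, a, hxa⟩, hMP⟩, hM⟩ :=
      ((Filter.Frequently.and_eventually hx hxP).and_eventually
        (eventually_ge_atTop (max N N₀))).exists
    have hM0 : N₀ ≤ M := (le_max_right _ _).trans hM
    obtain ⟨r, h0, h1, h2⟩ := hI M hM0 j hj a x ⟨hxa, hs⟩
    refine ⟨r, h0, hs, ?_⟩
    -- Since `x` is not in the good set at `M`, more than half of the ball lies in `H M`.
    have h3 : ¬ μ (ball x r) ≤ 2 * μ (ball x r \ H M) := fun h3 =>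
      hMP ⟨hM0, j, hj, r, h0, a, ⟨hxa, hs⟩, h1, h2, h3⟩
    have h4 : μ (ball x r) ≤ 2 * μ (ball x r ∩ H M) := by
      have e := measure_inter_add_sdiff (μ := μ) (ball x r) (hHm M)
      rw [← e] at h3 ⊢
      by_contra h5
      push Not at h3 h5
      have f1 : μ (ball x r ∩ H M) ≠ ⊤ := measure_ne_top _ _
      have f2 : μ (ball x r \ H M) ≠ ⊤ := measure_ne_top _ _
      generalize μ (ball x r ∩ H M) = p at *
      generalize μ (ball x r \ H M) = q at *
      lift p to NNReal using f1
      lift q to NNReal using f2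
      norm_cast at h3 h5
      have h3' : (2 * q : ℝ) < p + q := by exact_mod_cast h3
      have h5' : (2 * p : ℝ) < p + q := by exact_mod_cast h5
      linarith
    refine h4.trans ?_
    gcongr
    exact subset_iUnion₂_of_subset M ((le_max_left _ _).trans hM) subset_rfl
  refine measure_mono_null hsub ?_
  rw [measure_union_null_iff, measure_union_null_iff]
  exact ⟨Measure.measure_compl_support, hP, hbad⟩

end Transference

/-! ### Laurent series through their coefficients -/

variable {K : Type*} [Field K]

/-- The coefficient of `X^(-k)`, as a `K`-valued additive map. -/
noncomputable def lcoeff (k : ℤ) : LaurentInv K →+ K where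
  toFun f := f.toSeries.coeff k
  map_zero' := rfl
  map_add' _ _ := rfl

theorem norm_le_exp_iff (f : LaurentInv K) (k : ℤ) :
    ‖f‖ ≤ Real.exp (-(k : ℝ)) ↔ ∀ j < k, lcoeff j f = 0 := by
  by_cases hf : f = 0
  · subst hf
    simp [(Real.exp_pos _).le]
  · rw [LaurentInv.norm_of_ne hf, Real.exp_le_exp, neg_le_neg_iff, Int.cast_le]
    exact HahnSeries.le_order_iff_forall (x := f.toSeries) hf

theorem norm_lt_exp_iff (f : LaurentInv K) (k : ℤ) :
    ‖f‖ < Real.exp (-(k : ℝ)) ↔ ∀ j ≤ k, lcoeff j f = 0 := by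
  have : ‖f‖ < Real.exp (-(k : ℝ)) ↔ ‖f‖ ≤ Real.exp (-((k + 1 : ℤ) : ℝ)) := by
    by_cases hf : f = 0
    · subst hf
      simp [(Real.exp_pos _).le, Real.exp_pos]
    · rw [LaurentInv.norm_of_ne hf, Real.exp_le_exp, Real.exp_lt_exp, neg_le_neg_iff,
        neg_lt_neg_iff, Int.cast_le, Int.cast_lt, Int.add_one_le_iff]
  rw [this, norm_le_exp_iff]
  simp only [Int.lt_add_one_iff]

instance : IsUltrametricDist (LaurentInv K) :=
  IsUltrametricDist.isUltrametricDist_of_forall_norm_add_le_max_norm LaurentInv.norm_add_le_max'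

theorem norm_sub_lt {f g : LaurentInv K} {r : ℝ} (hf : ‖f‖ < r) (hg : ‖g‖ < r) : ‖f - g‖ < r := by
  rw [sub_eq_add_neg]
  refine (LaurentInv.norm_add_le_max' _ _).trans_lt (max_lt hf ?_)
  rwa [norm_neg]

theorem X_pow_eq (n : ℕ) :
    (LaurentInv.X : LaurentInv K) ^ n = (HahnSeries.single (-(n : ℤ)) (1 : K) : LaurentSeries K) := by
  have := HahnSeries.single_pow (Γ := ℤ) (-1) n (1 : K)
  simp only [one_pow, smul_neg, nsmul_eq_mul, mul_one] at this
  exact this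

theorem lcoeff_constIncl_mul (j : ℤ) (a : K) (f : LaurentInv K) :
    lcoeff j (constIncl a * f) = a * lcoeff j f :=
  HahnSeries.coeff_single_zero_mul (x := f.toSeries)

theorem lcoeff_X_pow_mul (j : ℤ) (n : ℕ) (f : LaurentInv K) :
    lcoeff j (LaurentInv.X ^ n * f) = lcoeff (j + n) f := by
  rw [X_pow_eq]
  have := HahnSeries.coeff_single_mul_add (r := (1 : K)) (x := f.toSeries) (a := j + n)
    (b := -(n : ℤ))
  rw [one_mul, add_neg_cancel_right] at this
  exact this

theorem lcoeff_one (j : ℤ) : lcoeff j (1 : LaurentInv K) = if j = 0 then 1 else 0 := by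
  classical
  have : lcoeff j (1 : LaurentInv K) = (1 : LaurentSeries K).coeff j := rfl
  rw [this, HahnSeries.coeff_one]
  congr

theorem lcoeff_polyIncl (p : K[X]) (j : ℕ) : lcoeff (-(j : ℤ)) (polyIncl p) = p.coeff j := by
  induction p using Polynomial.induction_on' with
  | add p q hp hq => rw [map_add, map_add, hp, hq, coeff_add]
  | monomial n a =>
    have : polyIncl (monomial n a) = constIncl a * (LaurentInv.X ^ n * 1) := by
      simp [polyIncl, eval₂_monomial]
    rw [this, lcoeff_constIncl_mul, lcoeff_X_pow_mul, lcoeff_one, coeff_monomial]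
    by_cases h : n = j
    · simp [h]
    · rw [if_neg h, if_neg (by omega), mul_zero]

theorem lcoeff_polyIncl_pos (p : K[X]) {j : ℤ} (hj : 0 < j) : lcoeff j (polyIncl p) = 0 := by
  induction p using Polynomial.induction_on' with
  | add p q hp hq => rw [map_add, map_add, hp, hq, add_zero]
  | monomial n a =>
    have : polyIncl (monomial n a) = constIncl a * (LaurentInv.X ^ n * 1) := by
      simp [polyIncl, eval₂_monomial]
    rw [this, lcoeff_constIncl_mul, lcoeff_X_pow_mul, lcoeff_one, if_neg (by omega), mul_zero]

theorem norm_polyIncl_lt_one {p : K[X]} (h : ‖polyIncl p‖ < 1) : p = 0 := by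
  have h' : ‖polyIncl p‖ < Real.exp (-((0 : ℤ) : ℝ)) := by simpa using h
  rw [norm_lt_exp_iff] at h'
  ext j
  rw [← lcoeff_polyIncl, h' _ (by omega), coeff_zero]

theorem one_le_norm_polyIncl {p : K[X]} (h : p ≠ 0) : 1 ≤ ‖polyIncl p‖ :=
  not_lt.mp fun h' => h (norm_polyIncl_lt_one h')

theorem norm_polyIncl_le_iff (p : K[X]) (d : ℕ) :
    ‖polyIncl p‖ ≤ Real.exp d ↔ ∀ j > d, p.coeff j = 0 := by
  have e : (d : ℝ) = -((-(d : ℤ) : ℤ) : ℝ) := by push_cast; ring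
  rw [e, norm_le_exp_iff]
  constructor
  · intro h j hj
    rw [← lcoeff_polyIncl]
    exact h _ (by omega)
  · intro h j hj
    obtain ⟨i, rfl⟩ : ∃ i : ℕ, j = -(i : ℤ) := ⟨(-j).toNat, by omega⟩
    rw [lcoeff_polyIncl]
    exact h _ (by omega)

theorem norm_polyIncl_le_natDegree (p : K[X]) : ‖polyIncl p‖ ≤ Real.exp p.natDegree :=
  (norm_polyIncl_le_iff _ _).mpr fun _ hj => coeff_eq_zero_of_natDegree_lt hj

theorem max_one_norm_polyIncl (p : K[X]) : max 1 ‖polyIncl p‖ = Real.exp p.natDegree := by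
  refine le_antisymm (max_le (Real.one_le_exp (by positivity)) (norm_polyIncl_le_natDegree p)) ?_
  by_cases h0 : p.natDegree = 0
  · simp [h0]
  refine le_max_of_le_right (not_lt.mp fun h => ?_)
  have e : (p.natDegree : ℝ) = -((-(p.natDegree : ℤ) : ℤ) : ℝ) := by push_cast; ring
  rw [e, norm_lt_exp_iff] at h
  have h1 := h _ le_rfl
  rw [lcoeff_polyIncl] at h1
  exact h0 (by rw [leadingCoeff_eq_zero.mp h1, natDegree_zero])

/-- Every series is the sum of a polynomial and a series of norm `< 1`. -/
theorem exists_polynomial_norm_add_lt_one (f : LaurentInv K) : ∃ p : K[X], ‖polyIncl p + f‖ < 1 := by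
  obtain ⟨N, hN⟩ : ∃ N : ℕ, ∀ j : ℤ, j < -(N : ℤ) → lcoeff j f = 0 := by
    refine ⟨(-f.toSeries.order).toNat, fun j hj => ?_⟩
    exact HahnSeries.coeff_eq_zero_of_lt_order (x := f.toSeries) (by omega)
  refine ⟨∑ i ∈ Finset.range (N + 1), monomial i (-lcoeff (-(i : ℤ)) f), ?_⟩
  have h1 : (1 : ℝ) = Real.exp (-((0 : ℤ) : ℝ)) := by simp
  rw [h1, norm_lt_exp_iff]
  intro j hj
  obtain ⟨i, rfl⟩ : ∃ i : ℕ, j = -(i : ℤ) := ⟨(-j).toNat, by omega⟩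
  rw [map_add, lcoeff_polyIncl, finsetSum_coeff]
  simp only [coeff_monomial, Finset.sum_ite_eq', Finset.mem_range]
  split_ifs with h
  · ring
  · rw [hN _ (by omega), zero_add]

instance countable_polynomial [Finite K] : Countable K[X] :=
  Function.Injective.countable (f := fun p : K[X] => p.toFinsupp.coeff) fun p q h => by
    ext n
    exact DFunLike.congr_fun h n

theorem norm_X : ‖(LaurentInv.X : LaurentInv K)‖ = Real.exp 1 := by
  have h := max_one_norm_polyIncl (X : K[X])
  have e : polyIncl (X : K[X]) = LaurentInv.X := by simp [polyIncl]
  rw [e, natDegree_X, Nat.cast_one] at h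
  rcases max_choice 1 ‖(LaurentInv.X : LaurentInv K)‖ with h' | h'
  · rw [h'] at h
    have := Real.exp_one_gt_d9
    linarith
  · rwa [h'] at h

instance [Finite K] : SecondCountableTopology (LaurentInv K) := by
  have hX : (LaurentInv.X : LaurentInv K) ≠ 0 := by
    rw [← norm_ne_zero_iff, norm_X]; exact (Real.exp_pos _).ne'
  have : TopologicalSpace.SeparableSpace (LaurentInv K) := by
    refine TopologicalSpace.SeparableSpace.of_denseRange
      (fun a : K[X] × ℕ => -((LaurentInv.X ^ a.2)⁻¹ * polyIncl a.1)) ?_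
    rw [Metric.denseRange_iff]
    intro f r hr
    obtain ⟨N, hN⟩ := exists_nat_gt (-Real.log r)
    -- Here `p` cancels the polynomial part of `X^N f`; dividing the rest by `X^N` makes it smaller
    -- than `e^(-N) < r`.
    obtain ⟨p, hp⟩ := exists_polynomial_norm_add_lt_one (LaurentInv.X ^ N * f)
    refine ⟨(p, N), ?_⟩
    have e : f - -((LaurentInv.X ^ N)⁻¹ * polyIncl p) =
        (LaurentInv.X ^ N)⁻¹ * (polyIncl p + LaurentInv.X ^ N * f) := by
      field_simp
      ring
    rw [dist_eq_norm, e, norm_mul, norm_inv, norm_pow, norm_X, ← Real.exp_nat_mul, mul_one,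
      ← Real.exp_neg]
    calc Real.exp (-N) * _ ≤ Real.exp (-N) * 1 := by gcongr
      _ < r := by
        rw [mul_one, ← Real.lt_log_iff_exp_lt hr]
        linarith
  exact UniformSpace.secondCountable_of_separable _

/-! ### Neighbourhoods of rational planes -/

theorem polyVec_sub {k : ℕ} (q q' : Fin k → K[X]) : polyVec (q - q') = polyVec q - polyVec q' := by
  ext i
  simp [polyVec]

theorem affineForm_sub {m n : ℕ} (Y : FMat K m n) (θ : Fin m → LaurentInv K)
    (p p' : Fin m → K[X]) (q q' : Fin n → K[X]) (i : Fin m) :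
    affineForm Y (polyVec (q - q')) (polyVec (p - p')) i =
      affineForm Y (polyVec q) (polyVec p + θ) i -
        affineForm Y (polyVec q') (polyVec p' + θ) i := by
  simp only [affineForm, polyVec_sub, Pi.sub_apply, Pi.add_apply, mul_sub, Finset.sum_sub_distrib]
  ring

theorem affineForm_smul {m n : ℕ} (Y : FMat K m n) (a : LaurentInv K) (b : Fin n → LaurentInv K)
    (c : Fin m → LaurentInv K) (i : Fin m) :
    affineForm Y (a • b) (a • c) i = a * affineForm Y b c i := by
  simp only [affineForm, Pi.smul_apply, smul_eq_mul, mul_add, Finset.mul_sum]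
  congr 1
  refine Finset.sum_congr rfl fun j _ => ?_
  ring

theorem affineForm_congr {m n : ℕ} (Y : FMat K m n) (b : Fin n → LaurentInv K)
    {c c' : Fin m → LaurentInv K} {i : Fin m} (h : c i = c' i) :
    affineForm Y b c i = affineForm Y b c' i := by
  simp only [affineForm, h]

theorem continuous_affineForm {m n : ℕ} (b : Fin n → LaurentInv K) (c : Fin m → LaurentInv K)
    (i : Fin m) : Continuous fun Y : FMat K m n => affineForm Y b c i := by
  refine (continuous_finsetSum _ fun j _ => Continuous.mul ?_ continuous_const).add continuous_const
  exact (continuous_apply j).comp (continuous_apply i)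

theorem norm_affineForm_zero_le {m n : ℕ} (Y : FMat K m n) {b : Fin n → LaurentInv K}
    (hb : ‖b‖ ≤ 1) {c : Fin m → LaurentInv K} {i : Fin m} (hc : c i = 0) :
    ‖affineForm Y b c i‖ ≤ ‖Y‖ := by
  simp only [affineForm, hc, add_zero]
  refine IsUltrametricDist.norm_sum_le_of_forall_le_of_nonneg (norm_nonneg _) fun j _ => ?_
  rw [norm_mul]
  calc ‖Y i j‖ * ‖b j‖ ≤ ‖Y‖ * 1 :=
        mul_le_mul ((norm_le_pi_norm (Y i) j).trans (norm_le_pi_norm Y i))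
          ((norm_le_pi_norm b j).trans hb) (norm_nonneg _) (norm_nonneg _)
    _ = ‖Y‖ := mul_one _

theorem exists_norm_polyVec_eq {n : ℕ} {q : Fin n → K[X]} (hq : q ≠ 0) :
    ∃ j, ‖polyVec q‖ = ‖polyIncl (q j)‖ ∧ 1 ≤ ‖polyIncl (q j)‖ := by
  obtain ⟨j₁, hj₁⟩ := Function.ne_iff.mp hq
  obtain ⟨j, -, hj⟩ := Finset.exists_max_image Finset.univ (fun j => ‖polyIncl (q j)‖)
    ⟨j₁, Finset.mem_univ _⟩
  refine ⟨j, le_antisymm ?_ (norm_le_pi_norm (polyVec q) j),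
    (one_le_norm_polyIncl hj₁).trans (hj _ (Finset.mem_univ _))⟩
  exact (pi_norm_le_iff_of_nonneg (norm_nonneg _)).mpr fun i => hj i (Finset.mem_univ _)

theorem IsDoubling.measure_ball_five_mul_le {m n : ℕ} {ν : Measure (FMat K m n)}
    (h : IsDoubling ν) : ∃ D : ENNReal, D ≠ ⊤ ∧ ∀ Y ∈ ν.support, ∀ r : ℝ, 0 < r →
      ν (Metric.ball Y (5 * r)) ≤ D * ν (Metric.ball Y r) := by
  obtain ⟨c, -, h⟩ := h
  -- Three doublings suffice, as `5 ≤ 2 ^ 3`.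
  refine ⟨ENNReal.ofReal c ^ 3, by finiteness, fun Y hY r hr => ?_⟩
  calc ν (Metric.ball Y (5 * r)) ≤ ν (Metric.ball Y (2 * (2 * (2 * r)))) :=
        measure_mono (Metric.ball_subset_ball (by linarith))
    _ ≤ ENNReal.ofReal c * (ENNReal.ofReal c * (ENNReal.ofReal c * ν (Metric.ball Y r))) := by
        refine (h Y hY _ (by positivity)).trans ?_
        gcongr
        refine (h Y hY _ (by positivity)).trans ?_
        gcongr
        exact h Y hY _ hr
    _ = _ := by ring

open Filter in
/-- The transference principle for neighbourhoods of rational planes. Only the rows in `S N j` are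
constrained; `Q N j` is the group of the vectors `q` that are admitted. -/
theorem measure_limsup_planes_eq_zero [Finite K] {m n : ℕ} {ν : Measure (FMat K m n)}
    [IsFiniteMeasure ν] (hν : IsDoubling ν) (θ : Fin m → LaurentInv K) {β : Type*} (N₀ : ℕ)
    (B : ℕ → Finset β) (S : ℕ → β → Finset (Fin m)) (ρ : ℕ → β → Fin m → ℝ)
    (Q : ℕ → β → AddSubgroup (Fin n → K[X])) (δ : ℕ → ℝ) (C α R : ℝ) (hδ : ∀ N, 0 < δ N)
    (hρ : ∀ N ≥ N₀, ∀ j ∈ B N, ∀ i ∈ S N j, ρ N j i / δ N ≤ 1)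
    (hc : ∀ N ≥ N₀, ∀ j ∈ B N, ∀ b c, ‖b‖ = 1 → ∀ M : ℝ, 1 ≤ M →
      ContractsAt ν C α b c (fun i => if i ∈ S N j then ρ N j i / δ N / M else R / δ N) (δ N))
    (hk : ∑' N, (B N).card * ENNReal.ofReal (C * δ N ^ α) ≠ ⊤)
    (hH : ν {Y | ∃ᶠ N in atTop, ∃ j ∈ B N, ∃ q ∈ Q N j, q ≠ 0 ∧ ∃ p : Fin m → K[X],
      ∀ i ∈ S N j, ‖affineForm Y (polyVec q) (polyVec p) i‖ < ρ N j i / δ N} = 0) :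
    ν {Y | ‖Y‖ < R ∧ ∃ᶠ N in atTop, ∃ j ∈ B N, ∃ q ∈ Q N j, q ≠ 0 ∧ ∃ p : Fin m → K[X],
      ∀ i ∈ S N j, ‖affineForm Y (polyVec q) (polyVec p + θ) i‖ < ρ N j i} = 0 := by
  obtain ⟨D, hDt, hD⟩ := hν.measure_ball_five_mul_le
  -- Pairs that differ only in entries of `p` on free rows would give the same `J` twice; setting
  -- these entries to 0 excludes this.
  set val : ℕ → β → (Fin m → K[X]) × (Fin n → K[X]) → Prop := fun N j a =>
    a.2 ∈ Q N j ∧ a.2 ≠ 0 ∧ ∀ i ∉ S N j, a.1 i = 0 with hval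
  set I : ℕ → β → (Fin m → K[X]) × (Fin n → K[X]) → Set (FMat K m n) := fun N j a =>
    {Y | val N j a ∧ ‖Y‖ < R ∧
      ∀ i ∈ S N j, ‖affineForm Y (polyVec a.2) (polyVec a.1 + θ) i‖ < ρ N j i} with hI
  set J : ℕ → β → (Fin m → K[X]) × (Fin n → K[X]) → Set (FMat K m n) := fun N j a =>
    {Y | val N j a ∧
      ∀ i ∈ S N j, ‖affineForm Y (polyVec a.2) (polyVec a.1 + θ) i‖ < ρ N j i / δ N} with hJ
  set H : ℕ → Set (FMat K m n) := fun N =>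
    {Y | ∃ j ∈ B N, ∃ q ∈ Q N j, q ≠ 0 ∧ ∃ p : Fin m → K[X],
      ∀ i ∈ S N j, ‖affineForm Y (polyVec q) (polyVec p) i‖ < ρ N j i / δ N} with hHdef
  have hHm : ∀ N, MeasurableSet (H N) := by
    intro N
    have e : H N = ⋃ j ∈ B N, ⋃ q ∈ {q | q ∈ Q N j ∧ q ≠ 0}, ⋃ p : Fin m → K[X], ⋂ i ∈ S N j,
        {Y | ‖affineForm Y (polyVec q) (polyVec p) i‖ < ρ N j i / δ N} := by
      ext Y
      simp only [hHdef, Set.mem_ofPred_eq, Set.mem_iUnion, Set.mem_iInter, exists_prop, and_assoc]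
    rw [e]
    refine IsOpen.measurableSet (isOpen_biUnion fun j _ => isOpen_biUnion fun q _ =>
      isOpen_iUnion fun p => isOpen_biInter_finset fun i _ => ?_)
    exact isOpen_lt (continuous_affineForm _ _ _).norm continuous_const
  have key := inhomogeneous_transference hDt hD N₀ B I J H
    (fun N => ENNReal.ofReal (C * δ N ^ α)) hHm ?_ ?_ hk hH
  · refine measure_mono_null ?_ key
    rintro Y ⟨hYR, hY⟩
    refine hY.mono ?_
    rintro N ⟨j, hj, q, hq, hq0, p, hp⟩
    classical
    refine ⟨j, hj, (fun i => if i ∈ S N j then p i else 0, q), ⟨hq, hq0, fun i hi => if_neg hi⟩,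
      hYR, fun i hi => ?_⟩
    rw [affineForm_congr (c' := polyVec p + θ)]
    · exact hp i hi
    · simp [polyVec, hi]
  · rintro N hN j hj ⟨p, q⟩ ⟨p', q'⟩ hne Y ⟨⟨⟨hq, hq0, hp0⟩, hY⟩, ⟨⟨hq', hq0', hp0'⟩, hY'⟩⟩
    dsimp only at *
    have hlt : ∀ i ∈ S N j,
        ‖affineForm Y (polyVec (q - q')) (polyVec (p - p')) i‖ < ρ N j i / δ N := by
      intro i hi
      rw [affineForm_sub Y θ]
      exact norm_sub_lt (hY i hi) (hY' i hi)
    -- For equal `q` the difference of the forms is the polynomial `p i - p' i`, which has norm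
    -- below 1 on the constrained rows and so vanishes there.
    by_cases hqq : q = q'
    · exfalso
      subst hqq
      apply hne
      congr 1
      ext1 i
      by_cases hi : i ∈ S N j
      · have h1 := (hlt i hi).trans_le (hρ N hN j hj i hi)
        have h2 : affineForm Y (polyVec (q - q)) (polyVec (p - p')) i = polyIncl (p i - p' i) := by
          simp [affineForm, polyVec]
        rw [h2] at h1
        exact sub_eq_zero.mp (norm_polyIncl_lt_one h1)
      · rw [hp0 i hi, hp0' i hi]
    · exact ⟨j, hj, q - q', (Q N j).sub_mem hq hq', sub_ne_zero.mpr hqq, p - p', hlt⟩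
  · rintro N hN j hj ⟨p, q⟩ Y ⟨⟨⟨hq, hq0, hp0⟩, hYR, hY⟩, hYs⟩
    dsimp only at *
    obtain ⟨l, hl, hl1⟩ := exists_norm_polyVec_eq hq0
    -- Division by an entry of largest norm normalises the plane to `‖b‖ = 1`; that norm is at least
    -- 1 and serves as `M` in `hc`.
    set a := polyIncl (q l) with ha
    have ha0 : 0 < ‖a‖ := by linarith
    classical
    set b : Fin n → LaurentInv K := a⁻¹ • polyVec q with hb
    -- On a free row `c i = 0`, and the condition of width `R` is automatic from `‖Y‖ < R`.
    set c : Fin m → LaurentInv K := fun i => if i ∈ S N j then (a⁻¹ • (polyVec p + θ)) i else 0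
      with hcdef
    have hb1 : ‖b‖ = 1 := by
      rw [hb, norm_smul, norm_inv, hl]
      exact inv_mul_cancel₀ ha0.ne'
    have hS : ∀ (Z : FMat K m n), ∀ i ∈ S N j,
        ‖affineForm Z b c i‖ = ‖affineForm Z (polyVec q) (polyVec p + θ) i‖ / ‖a‖ := by
      intro Z i hi
      rw [affineForm_congr (c' := a⁻¹ • (polyVec p + θ)) _ _ (by simp [hcdef, hi]),
        affineForm_smul, norm_mul, norm_inv]
      ring
    have hsub : ∀ Z : FMat K m n, Z ∈ I N j (p, q) → Z ∈ planeNhd b c (fun i => δ N *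
        if i ∈ S N j then ρ N j i / δ N / ‖a‖ else R / δ N) := by
      rintro Z ⟨-, hZR, hZ⟩ i
      have hd := hδ N
      dsimp only
      split_ifs with hi
      · rw [hS Z i hi]
        have : δ N * (ρ N j i / δ N / ‖a‖) = ρ N j i / ‖a‖ := by field_simp
        rw [this]
        exact div_lt_div_of_pos_right (hZ i hi) ha0
      · rw [mul_div_cancel₀ _ hd.ne']
        exact (norm_affineForm_zero_le Z hb1.le (by simp [hcdef, hi])).trans_lt hZR
    obtain ⟨r, h0, h1, h2⟩ := hc N hN j hj b c hb1 ‖a‖ hl1 Y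
      ⟨hsub Y ⟨⟨hq, hq0, hp0⟩, hYR, hY⟩, hYs⟩
    refine ⟨r, h0, fun Z hZ => ⟨⟨hq, hq0, hp0⟩, fun i hi => ?_⟩, ?_⟩
    · have h3 := h1 hZ i
      dsimp only at h3
      rw [if_pos hi, hS Z i hi] at h3
      exact (div_lt_div_iff_of_pos_right ha0).mp h3
    · exact (measure_mono (Set.inter_subset_inter_right _ hsub)).trans h2

/-! ### The upper bound for contracting measures -/

/-- The set of exponents whose supremum is `expo Y θ`. -/
def expoSet {m n : ℕ} (Y : FMat K m n) (θ : Fin m → LaurentInv K) : Set ℝ :=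
  {w : ℝ | 0 ≤ w ∧ ∀ T₀ : ℝ, ∃ T : ℝ, T₀ ≤ T ∧ 1 ≤ T ∧
    ∃ (p : Fin m → K[X]) (q : Fin n → K[X]), q ≠ 0 ∧
      ‖affineForm Y (polyVec q) (polyVec p + θ)‖ ^ m < Real.exp (-w * T) ∧
      ‖polyVec q‖ ^ n < Real.exp T}

/-- The set of exponents whose supremum is `mulExpo Y θ`. -/
def mulExpoSet {m n : ℕ} (Y : FMat K m n) (θ : Fin m → LaurentInv K) : Set ℝ :=
  {w : ℝ | 0 ≤ w ∧ ∀ T₀ : ℝ, ∃ T : ℝ, T₀ ≤ T ∧ 1 ≤ T ∧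
    ∃ (p : Fin m → K[X]) (q : Fin n → K[X]), q ≠ 0 ∧
      ∏ i, ‖affineForm Y (polyVec q) (polyVec p + θ) i‖ < Real.exp (-w * T) ∧
      ∏ j, max 1 ‖polyVec q j‖ < Real.exp T}

theorem sSup_coe_image_le_one_iff {W : Set ℝ} :
    sSup (Real.toEReal '' W) ≤ 1 ↔ ∀ w ∈ W, w ≤ 1 := by
  simp only [sSup_le_iff, Set.forall_mem_image, ← EReal.coe_one, EReal.coe_le_coe_iff]

theorem expo_le_one_iff {m n : ℕ} {Y : FMat K m n} {θ : Fin m → LaurentInv K} :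
    expo Y θ ≤ 1 ↔ ∀ w ∈ expoSet Y θ, w ≤ 1 :=
  sSup_coe_image_le_one_iff

theorem mulExpo_le_one_iff {m n : ℕ} {Y : FMat K m n} {θ : Fin m → LaurentInv K} :
    mulExpo Y θ ≤ 1 ↔ ∀ w ∈ mulExpoSet Y θ, w ≤ 1 :=
  sSup_coe_image_le_one_iff

/-- Almost everywhere bounds on random sets of exponents, by exhaustion. -/
theorem ae_forall_le_one {m n : ℕ} {ν : Measure (FMat K m n)} {W : FMat K m n → Set ℝ}
    (h : ∀ η : ℝ, 0 < η → ∀ R : ℝ, 0 < R → ν {Y | ‖Y‖ < R ∧ ∃ w ∈ W Y, 1 + η ≤ w} = 0) :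
    ∀ᵐ Y ∂ν, ∀ w ∈ W Y, w ≤ 1 := by
  rw [ae_iff]
  refine measure_mono_null (t := ⋃ k : ℕ × ℕ, {Y | ‖Y‖ < (k.1 + 1 : ℝ) ∧
    ∃ w ∈ W Y, 1 + 1 / (k.2 + 1 : ℝ) ≤ w}) ?_
    (measure_iUnion_null fun k => h _ (by positivity) _ (by positivity))
  intro Y hY
  simp only [Set.mem_ofPred_eq, not_forall, not_le] at hY
  obtain ⟨w, hw, hw1⟩ := hY
  obtain ⟨k, hk⟩ := exists_nat_one_div_lt (sub_pos.mpr hw1)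
  obtain ⟨l, hl⟩ := exists_nat_gt ‖Y‖
  exact Set.mem_iUnion.mpr ⟨(l, k), hl.trans (by simp), w, hw, by linarith⟩

/-- The vectors `q` with `‖q‖^n < r`. -/
def normPowLT {n : ℕ} (hn : n ≠ 0) {r : ℝ} (hr : 0 < r) : AddSubgroup (Fin n → K[X]) where
  carrier := {q | ‖polyVec q‖ ^ n < r}
  zero_mem' := by
    have : polyVec (0 : Fin n → K[X]) = 0 := by ext; simp [polyVec]
    simpa [this, hn] using hr
  add_mem' := by
    intro q q' hq hq'
    have e : polyVec (q + q') = polyVec q + polyVec q' := by ext; simp [polyVec]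
    have h := IsUltrametricDist.norm_add_le_max (polyVec q) (polyVec q')
    rw [← e] at h
    rcases le_max_iff.mp h with h | h
    · exact (pow_le_pow_left₀ (norm_nonneg _) h n).trans_lt hq
    · exact (pow_le_pow_left₀ (norm_nonneg _) h n).trans_lt hq'
  neg_mem' := by
    intro q hq
    have e : polyVec (-q) = -polyVec q := by ext; simp [polyVec]
    simpa [e] using hq

-- The neighbourhoods have exponent `1 + η/2` and their enlargements `1 + η/4`. The latter is still
-- above 1, so the homogeneous limsup is null, while the gap makes `δ^α` summable.
open Filter in
theorem Contracting.ae_expo_le_one [Finite K] {m n : ℕ} (hm : 0 < m) (hn : 0 < n)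
    {ν : Measure (FMat K m n)} (hν : Contracting ν) (h0 : ∀ᵐ Y ∂ν, expo Y 0 ≤ 1)
    (θ : Fin m → LaurentInv K) : ∀ᵐ Y ∂ν, expo Y θ ≤ 1 := by
  have := hν.finite
  obtain ⟨C, α, r₀, hC, hα, hr₀, hc⟩ := hν.contracts
  simp only [expo_le_one_iff] at h0 ⊢
  refine ae_forall_le_one fun η hη R hR => ?_
  have hm' : (0 : ℝ) < m := by exact_mod_cast hm
  obtain ⟨N₀, hN₀⟩ := exists_nat_gt (max 1 (-(m * Real.log r₀)))
  have hN1 : (1 : ℝ) < N₀ := (le_max_left _ _).trans_lt hN₀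
  have hN2 : -(m * Real.log r₀) < N₀ := (le_max_right _ _).trans_lt hN₀
  set ρ : ℕ → ℝ := fun N => Real.exp (-(1 + η / 2) * N / m) with hρ
  set δ : ℕ → ℝ := fun N => Real.exp (-(η / 4) * N / m) with hδ
  have hρδ : ∀ N, ρ N / δ N = Real.exp (-(1 + η / 4) * N / m) := by
    intro N
    rw [hρ, hδ, ← Real.exp_sub]
    ring_nf
  have hpow : ∀ a : ℝ, Real.exp (a / m) ^ m = Real.exp a := by
    intro a
    rw [← Real.exp_nat_mul]
    field_simp
  have key := measure_limsup_planes_eq_zero hν.doubling θ N₀ (fun _ => {()})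
    (fun _ _ => Finset.univ) (fun N _ _ => ρ N)
    (fun N _ => normPowLT hn.ne' (Real.exp_pos N)) δ C α R (fun N => Real.exp_pos _) ?_ ?_ ?_ ?_
  · refine measure_mono_null ?_ key
    rintro Y ⟨hYR, w, ⟨-, hw⟩, hηw⟩
    refine ⟨hYR, frequently_atTop.mpr fun N₁ => ?_⟩
    -- The bound on `T` pays for rounding it up to an integer: `(1 + η/2)(T + 1) ≤ (1 + η)T`.
    obtain ⟨T, hT, hT1, p, q, hq0, hp, hq⟩ := hw (max N₁ (2 * (1 + η) / η))
    have hTN : T ≤ ⌈T⌉₊ := Nat.le_ceil T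
    have hNT : (⌈T⌉₊ : ℝ) < T + 1 := Nat.ceil_lt_add_one (by linarith)
    refine ⟨⌈T⌉₊, ?_, (), Finset.mem_singleton_self _, q, ?_, hq0, p, fun i _ => ?_⟩
    · exact_mod_cast ((le_max_left _ _).trans hT).trans hTN
    · exact hq.trans_le (Real.exp_le_exp.mpr hTN)
    · refine (norm_le_pi_norm _ i).trans_lt (lt_of_pow_lt_pow_left₀ m (Real.exp_pos _).le ?_)
      rw [hpow]
      refine hp.trans_le (Real.exp_le_exp.mpr ?_)
      have h2 : 2 * (1 + η) ≤ T * η := (div_le_iff₀ hη).mp ((le_max_right _ _).trans hT)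
      nlinarith
  · intro N _ _ _ i _
    rw [hρδ, Real.exp_le_one_iff]
    rw [neg_mul, neg_div, neg_nonpos]
    positivity
  · intro N hN _ _ b c hb M hM
    have hNN : (N₀ : ℝ) ≤ N := by exact_mod_cast hN
    simp only [Finset.mem_univ, if_true]
    have hpos : 0 < ρ N / δ N := by rw [hρδ]; exact Real.exp_pos _
    refine hc b c hb _ (by positivity) ?_ _ (Real.exp_pos _) ?_
    · refine (div_le_self hpos.le hM).trans_lt ?_
      rw [hρδ, ← Real.lt_log_iff_exp_lt hr₀, div_lt_iff₀ hm']
      nlinarith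
    · rw [hδ, Real.exp_lt_one_iff]
      refine div_neg_of_neg_of_pos ?_ hm'
      nlinarith
  · simp only [Finset.card_singleton, Nat.cast_one, one_mul]
    refine Summable.tsum_ofReal_ne_top ?_
    refine Summable.mul_left C ?_
    have hs := Real.summable_exp_nat_mul_of_ge (c := -(η / 4 / m * α)) (by
      have : 0 < η / 4 / m * α := by positivity
      linarith) (f := fun i => i) (fun i => le_rfl)
    refine hs.congr fun N => ?_
    rw [hδ, ← Real.exp_mul]
    congr 1
    ring
  · refine measure_mono_null ?_ (ae_iff.mp h0)
    intro Y hY hY1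
    have h1 := hY1 (1 + η / 4) ?_
    · linarith
    refine ⟨by positivity, fun T₀ => ?_⟩
    obtain ⟨N₁, hN₁⟩ := exists_nat_ge (max T₀ 1)
    obtain ⟨N, hN, -, -, q, hq, hq0, p, hp⟩ := frequently_atTop.mp hY N₁
    have hNN : (N₁ : ℝ) ≤ N := by exact_mod_cast hN
    refine ⟨N, ((le_max_left _ _).trans hN₁).trans hNN, ((le_max_right _ _).trans hN₁).trans hNN,
      p, q, hq0, ?_, hq⟩
    simp only [Finset.mem_univ, true_imp_iff, hρδ] at hp
    rw [add_zero, ← hpow]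
    exact pow_lt_pow_left₀ ((pi_norm_lt_iff (Real.exp_pos _)).mpr hp) (norm_nonneg _) hm.ne'

/-! ### The multiplicative upper bound for strongly contracting measures -/

/-- The vectors `q` with `deg q_j ≤ s_j`. -/
def natDegreeLE {n : ℕ} (s : Fin n → ℕ) : AddSubgroup (Fin n → K[X]) where
  carrier := {q | ∀ j, (q j).natDegree ≤ s j}
  zero_mem' := by simp
  add_mem' hq hq' j := natDegree_add_le_of_degree_le (hq j) (hq' j)
  neg_mem' hq j := by simpa using hq j

theorem prod_max_one_norm_polyVec {n : ℕ} (q : Fin n → K[X]) :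
    ∏ j, max 1 ‖polyVec q j‖ = Real.exp (∑ j, (q j).natDegree : ℕ) := by
  rw [Nat.cast_sum, Real.exp_sum]
  exact Finset.prod_congr rfl fun j _ => max_one_norm_polyIncl (q j)

/-- A form already below 1 is kept; otherwise its polynomial part is removed. Only the `i`-th entry
of `p''` matters, so the rows can be treated independently. -/
theorem exists_polyVec_norm_lt_one {m n : ℕ} (Y : FMat K m n) (b : Fin n → LaurentInv K)
    (θ : Fin m → LaurentInv K) (i : Fin m) (p : Fin m → K[X]) : ∃ p' : K[X],
    ∀ p'' : Fin m → K[X], p'' i = p' → ‖affineForm Y b (polyVec p'' + θ) i‖ < 1 ∧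
      ‖affineForm Y b (polyVec p'' + θ) i‖ ≤ ‖affineForm Y b (polyVec p + θ) i‖ := by
  by_cases h : ‖affineForm Y b (polyVec p + θ) i‖ < 1
  · refine ⟨p i, fun p'' hp => ?_⟩
    rw [affineForm_congr (c' := polyVec p + θ) _ _ (by simp [polyVec, hp])]
    exact ⟨h, le_rfl⟩
  · obtain ⟨p', hp'⟩ := exists_polynomial_norm_add_lt_one (∑ j, Y i j * b j + θ i)
    refine ⟨p', fun p'' hp => ?_⟩
    have e : affineForm Y b (polyVec p'' + θ) i = polyIncl p' + (∑ j, Y i j * b j + θ i) := by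
      simp only [affineForm, Pi.add_apply, polyVec, hp]
      ring
    rw [e]
    exact ⟨hp', hp'.le.trans (not_lt.mp h)⟩

theorem exists_reduced_polyVec {m n : ℕ} (Y : FMat K m n) (b : Fin n → LaurentInv K)
    (θ : Fin m → LaurentInv K) (p : Fin m → K[X]) : ∃ p' : Fin m → K[X],
    ∀ i, ‖affineForm Y b (polyVec p' + θ) i‖ < 1 ∧
      ‖affineForm Y b (polyVec p' + θ) i‖ ≤ ‖affineForm Y b (polyVec p + θ) i‖ := by
  choose p' hp' using fun i => exists_polyVec_norm_lt_one Y b θ i p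
  exact ⟨p', fun i => hp' i p' rfl⟩

/-- A zero or tiny entry has no bounded order; the cap `L` keeps the set of order vectors finite. An
order different from the cap is exact. -/
theorem exists_capped_order {f : LaurentInv K} (hf : ‖f‖ < 1) (L : ℕ) :
    ∃ t : ℕ, t ≤ L ∧ ‖f‖ ≤ Real.exp (-t) ∧ (t = L ∨ ‖f‖ = Real.exp (-t)) := by
  by_cases h0 : f = 0
  · exact ⟨L, le_rfl, by simp [h0, (Real.exp_pos _).le], Or.inl rfl⟩
  rw [LaurentInv.norm_of_ne h0] at hf ⊢
  have ho : 0 < f.toSeries.order := by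
    rw [Real.exp_lt_one_iff, neg_lt_zero] at hf
    exact_mod_cast hf
  obtain ⟨a, ha⟩ := Int.eq_ofNat_of_zero_le ho.le
  rw [ha]
  rcases le_total a L with h | h
  · exact ⟨a, h, le_rfl, Or.inr rfl⟩
  · refine ⟨L, le_rfl, ?_, Or.inl rfl⟩
    rw [Real.exp_le_exp]
    simpa using h

/-- One capped order alone contributes `L ≥ a`; if none is capped, the product determines the sum of
the orders. -/
theorem exists_capped_orders {m : ℕ} {f : Fin m → LaurentInv K} (hf : ∀ i, ‖f i‖ < 1) (L : ℕ)
    {a : ℝ} (ha : a ≤ L) (hprod : ∏ i, ‖f i‖ < Real.exp (-a)) :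
    ∃ t : Fin m → ℕ, (∀ i, t i ≤ L) ∧ (∀ i, ‖f i‖ ≤ Real.exp (-t i)) ∧ a ≤ ∑ i, (t i : ℝ) := by
  choose t ht1 ht2 ht3 using fun i => exists_capped_order (hf i) L
  refine ⟨t, ht1, ht2, ?_⟩
  by_cases h : ∃ i, t i = L
  · obtain ⟨i, hi⟩ := h
    refine ha.trans ?_
    rw [← hi]
    exact Finset.single_le_sum (f := fun i => (t i : ℝ)) (fun _ _ => by positivity)
      (Finset.mem_univ i)
  · push Not at h
    have e : ∏ i, ‖f i‖ = Real.exp (-∑ i, (t i : ℝ)) := by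
      rw [← Finset.sum_neg_distrib, Real.exp_sum]
      exact Finset.prod_congr rfl fun i _ => (ht3 i).resolve_left (h i)
    rw [e, Real.exp_lt_exp] at hprod
    linarith

/-- The pairs `(t, s)` of vectors of orders of size about `N`. -/
noncomputable def orderVectors (m n : ℕ) (w : ℝ) (N : ℕ) : Finset ((Fin m → ℕ) × (Fin n → ℕ)) :=
  open Classical in
  (Fintype.piFinset (fun _ => Finset.range (⌈w * N⌉₊ + 1)) ×ˢ
    Fintype.piFinset (fun _ => Finset.range (N + 1))).filter
      fun a => ∑ j, a.2 j < N ∧ w * (N - 1) ≤ ∑ i, (a.1 i : ℝ)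

theorem mem_orderVectors {m n : ℕ} {w : ℝ} {N : ℕ} {a : (Fin m → ℕ) × (Fin n → ℕ)} :
    a ∈ orderVectors m n w N ↔ ((∀ i, a.1 i ≤ ⌈w * N⌉₊) ∧ ∀ j, a.2 j ≤ N) ∧
      ∑ j, a.2 j < N ∧ w * (N - 1) ≤ ∑ i, (a.1 i : ℝ) := by
  simp [orderVectors, Fintype.mem_piFinset]

theorem card_orderVectors_le (m n : ℕ) {w : ℝ} (hw : 0 ≤ w) (N : ℕ) :
    ((orderVectors m n w N).card : ℝ) ≤ (w + 2) ^ m * ((N : ℝ) + 1) ^ (m + n) := by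
  have h1 : (orderVectors m n w N).card ≤ (⌈w * N⌉₊ + 1) ^ m * (N + 1) ^ n := by
    refine (Finset.card_filter_le _ _).trans ?_
    simp [Finset.card_product]
  have h2 : (⌈w * N⌉₊ : ℝ) + 1 ≤ (w + 2) * (N + 1) := by
    have h := Nat.ceil_lt_add_one (a := w * N) (by positivity)
    have hN : (0 : ℝ) ≤ N := by positivity
    nlinarith
  calc ((orderVectors m n w N).card : ℝ) ≤ ((⌈w * N⌉₊ : ℝ) + 1) ^ m * ((N : ℝ) + 1) ^ n := by
        exact_mod_cast h1
    _ ≤ ((w + 2) * (N + 1)) ^ m * ((N : ℝ) + 1) ^ n := by gcongr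
    _ = _ := by rw [mul_pow, pow_add]; ring

theorem tsum_card_orderVectors_ne_top (m n : ℕ) {w : ℝ} (hw : 0 ≤ w) (C : ℝ) {c : ℝ} (hc : 0 < c) :
    ∑' N : ℕ, ((orderVectors m n w N).card : ENNReal) * ENNReal.ofReal (C * Real.exp (-c * N)) ≠
      ⊤ := by
  have hs := (summable_nat_add_iff 1).mpr (Real.summable_pow_mul_exp_neg_nat_mul (m + n) hc)
  have hs2 := hs.mul_left ((w + 2) ^ m * |C| * Real.exp c)
  refine ne_top_of_le_ne_top hs2.tsum_ofReal_ne_top (ENNReal.tsum_le_tsum fun N => ?_)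
  rw [← ENNReal.ofReal_natCast, ← ENNReal.ofReal_mul (by positivity)]
  refine ENNReal.ofReal_le_ofReal ?_
  have e : Real.exp (-c * N) = Real.exp c * Real.exp (-c * ((N + 1 : ℕ) : ℝ)) := by
    rw [← Real.exp_add]
    push_cast
    ring_nf
  calc _ ≤ ((orderVectors m n w N).card : ℝ) * (|C| * Real.exp (-c * N)) := by
        gcongr
        exact le_abs_self C
    _ ≤ ((w + 2) ^ m * ((N : ℝ) + 1) ^ (m + n)) * (|C| * Real.exp (-c * N)) := by
        gcongr
        exact card_orderVectors_le m n hw N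
    _ = _ := by rw [e]; push_cast; ring

-- Approximations are sorted by the orders `t i` of the rows and the degrees of the `q j`. A row of
-- small order could exceed width 1 when enlarged, which would spoil disjointness, so rows with `t i
-- < 2σN` are left free.
open Filter in
theorem StronglyContracting.ae_mulExpo_le_one [Finite K] {m n : ℕ} (hm : 0 < m)
    {ν : Measure (FMat K m n)} (hν : StronglyContracting ν) (h0 : ∀ᵐ Y ∂ν, mulExpo Y 0 ≤ 1)
    (θ : Fin m → LaurentInv K) : ∀ᵐ Y ∂ν, mulExpo Y θ ≤ 1 := by
  have := hν.finite
  obtain ⟨C, α, r₀, hC, hα, hr₀, hc⟩ := hν.contracts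
  simp only [mulExpo_le_one_iff] at h0 ⊢
  refine ae_forall_le_one fun η hη R hR => ?_
  have hm' : (0 : ℝ) < m := by exact_mod_cast hm
  -- The total loss below is `3mσN = ηN/4`, which leaves room for the exponent `1 + η/2`.
  obtain ⟨σ, hσ⟩ : ∃ σ, σ = η / (12 * m) := ⟨_, rfl⟩
  have hσ0 : 0 < σ := by rw [hσ]; positivity
  have hσm : m * σ = η / 12 := by rw [hσ]; field_simp
  obtain ⟨N₀, hN₀⟩ := exists_nat_gt (max 2 (max (1 / σ) ((1 - Real.log r₀) / σ)))
  have hN2 : (2 : ℝ) < N₀ := (le_max_left _ _).trans_lt hN₀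
  have hN3 : 1 < N₀ * σ := (div_lt_iff₀ hσ0).mp
    (((le_max_left _ _).trans (le_max_right _ _)).trans_lt hN₀)
  have hN4 : 1 - Real.log r₀ < N₀ * σ := (div_lt_iff₀ hσ0).mp
    (((le_max_right _ _).trans (le_max_right _ _)).trans_lt hN₀)
  classical
  set S : ℕ → (Fin m → ℕ) × (Fin n → ℕ) → Finset (Fin m) :=
    fun N a => Finset.univ.filter fun i => 2 * σ * N ≤ a.1 i with hS
  -- The factor `e` turns the bound `exp (-t i)` into a strict inequality.
  set ρ : ℕ → (Fin m → ℕ) × (Fin n → ℕ) → Fin m → ℝ := fun _ a i => Real.exp (1 - a.1 i) with hρ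
  set δ : ℕ → ℝ := fun N => Real.exp (-σ * N) with hδ
  have hρδ : ∀ N a i, ρ N a i / δ N = Real.exp (1 - a.1 i + σ * N) := by
    intro N a i
    rw [hρ, hδ, ← Real.exp_sub]
    ring_nf
  have key := measure_limsup_planes_eq_zero hν.doubling θ N₀ (orderVectors m n (1 + η)) S ρ
    (fun _ a => natDegreeLE a.2) δ C α R (fun N => Real.exp_pos _) ?_ ?_ ?_ ?_
  · refine measure_mono_null ?_ key
    rintro Y ⟨hYR, w, ⟨-, hw⟩, hηw⟩
    refine ⟨hYR, frequently_atTop.mpr fun N₁ => ?_⟩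
    obtain ⟨T, hT, hT1, p, q, hq0, hp, hq⟩ := hw N₁
    have hTN : T ≤ ⌈T⌉₊ := Nat.le_ceil T
    have hNT : (⌈T⌉₊ : ℝ) < T + 1 := Nat.ceil_lt_add_one (by linarith)
    obtain ⟨p', hp'⟩ := exists_reduced_polyVec Y (polyVec q) θ p
    have hle : ∏ i, ‖affineForm Y (polyVec q) (polyVec p' + θ) i‖ <
        Real.exp (-((1 + η) * (⌈T⌉₊ - 1))) := by
      refine ((Finset.prod_le_prod (fun _ _ => norm_nonneg _) fun i _ => (hp' i).2).trans_lt
        hp).trans_le (Real.exp_le_exp.mpr ?_)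
      nlinarith
    obtain ⟨t, ht1, ht2, ht3⟩ := exists_capped_orders (fun i => (hp' i).1) ⌈(1 + η) * ⌈T⌉₊⌉₊
      (le_trans (by nlinarith) (Nat.le_ceil _)) hle
    rw [prod_max_one_norm_polyVec, Real.exp_lt_exp] at hq
    have hq' : ∑ j, (q j).natDegree < ⌈T⌉₊ := by exact_mod_cast hq.trans_le hTN
    refine ⟨⌈T⌉₊, ?_, (t, fun j => (q j).natDegree), ?_, q, fun j => le_rfl, hq0, p',
      fun i _ => ?_⟩
    · exact_mod_cast hT.trans hTN
    · refine mem_orderVectors.mpr ⟨⟨ht1, fun j => ?_⟩, hq', ht3⟩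
      exact (Finset.single_le_sum (f := fun j => (q j).natDegree) (fun _ _ => Nat.zero_le _)
        (Finset.mem_univ j)).trans hq'.le
    · exact (ht2 i).trans_lt (Real.exp_lt_exp.mpr (by simp))
  · intro N hN a _ i hi
    have hNN : (N₀ : ℝ) ≤ N := by exact_mod_cast hN
    simp only [hS, Finset.mem_filter, Finset.mem_univ, true_and] at hi
    rw [hρδ, Real.exp_le_one_iff]
    nlinarith
  · intro N hN a ha b c hb M hM
    have hNN : (N₀ : ℝ) ≤ N := by exact_mod_cast hN
    have hpos : ∀ i, 0 < ρ N a i / δ N := fun i => by rw [hρδ]; exact Real.exp_pos _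
    have hδ0 : 0 < δ N := Real.exp_pos _
    refine hc b c hb _ (fun i => ?_) ?_ _ hδ0 ?_
    · have := hpos i
      split_ifs <;> positivity
    -- If all rows were free, the orders would sum to at most `2mσN = ηN/6`, less than `(1 + η)(N -
    -- 1)`.
    · obtain ⟨i, hi⟩ : ∃ i, i ∈ S N a := by
        by_contra hne
        push Not at hne
        have h1 : ∑ i, (a.1 i : ℝ) ≤ ∑ _i : Fin m, 2 * σ * N :=
          Finset.sum_le_sum fun i _ => by
            have := hne i
            simp only [hS, Finset.mem_filter, Finset.mem_univ, true_and, not_le] at this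
            exact this.le
        rw [Finset.sum_const, Finset.card_univ, Fintype.card_fin, nsmul_eq_mul,
          show (m : ℝ) * (2 * σ * N) = 2 * (m * σ) * N by ring, hσm] at h1
        have h2 := (mem_orderVectors.mp ha).2.2
        nlinarith
      refine ⟨i, ?_⟩
      rw [if_pos hi]
      refine (div_le_self (hpos i).le hM).trans_lt ?_
      simp only [hS, Finset.mem_filter, Finset.mem_univ, true_and] at hi
      rw [hρδ, ← Real.lt_log_iff_exp_lt hr₀]
      nlinarith
    · rw [hδ, Real.exp_lt_one_iff]
      nlinarith
  · have h := tsum_card_orderVectors_ne_top m n (w := 1 + η) (by positivity) C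
      (c := σ * α) (by positivity)
    convert h using 6 with N
    rw [hδ, ← Real.exp_mul]
    congr 1
    ring
  · refine measure_mono_null ?_ (ae_iff.mp h0)
    intro Y hY hY1
    have h1 := hY1 (1 + η / 2) ?_
    · linarith
    refine ⟨by positivity, fun T₀ => ?_⟩
    -- The last bound gives `m - (1 + η)(N - 1) + ηN/4 < -(1 + η/2)N`.
    obtain ⟨N₁, hN₁⟩ := exists_nat_gt (max T₀ (max 1 ((m + 1 + η) / (η / 4))))
    obtain ⟨N, hN, a, ha, q, hq, hq0, p, hp⟩ := frequently_atTop.mp hY N₁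
    have hNN : (N₁ : ℝ) ≤ N := by exact_mod_cast hN
    have hT : T₀ < N := ((le_max_left _ _).trans_lt hN₁).trans_le hNN
    have hT1 : 1 < (N : ℝ) :=
      (((le_max_left _ _).trans (le_max_right _ _)).trans_lt hN₁).trans_le hNN
    have hT2 : m + 1 + η < N * (η / 4) := (div_lt_iff₀ (by positivity)).mp
      ((((le_max_right _ _).trans (le_max_right _ _)).trans_lt hN₁).trans_le hNN)
    -- Membership in the limsup says nothing about the free rows; a new choice of `p` there brings
    -- the forms below 1.
    choose p₁ hp₁ using fun i => exists_polyVec_norm_lt_one Y (polyVec q) 0 i p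
    refine ⟨N, hT.le, hT1.le, fun i => if i ∈ S N a then p i else p₁ i, q, hq0, ?_, ?_⟩
    · have hfac : ∀ i, ‖affineForm Y (polyVec q)
          (polyVec (fun i => if i ∈ S N a then p i else p₁ i) + 0) i‖ ≤
          Real.exp (1 - a.1 i + 3 * σ * N) := by
        intro i
        by_cases hi : i ∈ S N a
        · rw [affineForm_congr (c' := polyVec p) _ _ (by simp [polyVec, hi])]
          refine (hp i hi).le.trans ?_
          rw [hρδ, Real.exp_le_exp]
          nlinarith
        · refine (hp₁ i _ (if_neg hi)).1.le.trans (Real.one_le_exp ?_)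
          simp only [hS, Finset.mem_filter, Finset.mem_univ, true_and, not_le] at hi
          nlinarith
      refine (Finset.prod_le_prod (fun _ _ => norm_nonneg _) fun i _ => hfac i).trans_lt ?_
      rw [← Real.exp_sum, Real.exp_lt_exp, Finset.sum_add_distrib, Finset.sum_sub_distrib]
      simp only [Finset.sum_const, Finset.card_univ, Fintype.card_fin, nsmul_eq_mul, mul_one]
      rw [show (m : ℝ) * (3 * σ * N) = 3 * (m * σ) * N by ring, hσm]
      have h2 := (mem_orderVectors.mp ha).2.2
      nlinarith
    · rw [prod_max_one_norm_polyVec, Real.exp_lt_exp]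
      have h3 : ∑ j, (q j).natDegree ≤ ∑ j, a.2 j := Finset.sum_le_sum fun j _ => hq j
      exact_mod_cast h3.trans_lt (mem_orderVectors.mp ha).2.1

/-! ### Digits of `Yq` and the lower bound -/

theorem polyIncl_smul (a : K) (p : K[X]) : polyIncl (a • p) = constIncl a * polyIncl p := by
  rw [smul_eq_C_mul, map_mul]
  congr 1
  simp [polyIncl]

theorem polyIncl_X_mul (p : K[X]) : polyIncl (X * p) = LaurentInv.X ^ 1 * polyIncl p := by
  rw [map_mul, pow_one]
  congr 1
  simp [polyIncl]

/-- The digits of the fractional parts of the entries of `Yq`: the entry `(i, l)` is the coefficient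
of `X^(-(l+1))` in `(Yq)_i`. -/
noncomputable def fracDigits {m n : ℕ} (Y : FMat K m n) :
    (Fin n → K[X]) →ₗ[K] (Fin m → ℕ → K) where
  toFun q i l := lcoeff (l + 1) (∑ j, Y i j * polyIncl (q j))
  map_add' q q' := by
    ext i l
    simp [mul_add, Finset.sum_add_distrib]
  map_smul' a q := by
    ext i l
    simp only [Pi.smul_apply, polyIncl_smul, RingHom.id_apply, smul_eq_mul]
    rw [← lcoeff_constIncl_mul, Finset.mul_sum]
    congr 1
    exact Finset.sum_congr rfl fun j _ => by ring

theorem fracDigits_apply {m n : ℕ} (Y : FMat K m n) (q : Fin n → K[X]) (i : Fin m) (l : ℕ) :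
    fracDigits Y q i l = lcoeff (l + 1) (∑ j, Y i j * polyIncl (q j)) := rfl

/-- Coordinatewise multiplication by `X`. -/
noncomputable def mulX (K : Type*) [Field K] (n : ℕ) : (Fin n → K[X]) →ₗ[K] (Fin n → K[X]) :=
  LinearMap.pi fun j => LinearMap.mulLeft K X ∘ₗ LinearMap.proj j

theorem mulX_apply {n : ℕ} (q : Fin n → K[X]) (j : Fin n) : mulX K n q j = X * q j := rfl

theorem mulX_injective (n : ℕ) : Function.Injective (mulX K n) := by
  intro q q' h
  ext1 j
  exact mul_left_cancel₀ X_ne_zero (congrFun h j)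

theorem fracDigits_mulX {m n : ℕ} (Y : FMat K m n) (q : Fin n → K[X]) (i : Fin m) (l : ℕ) :
    fracDigits Y (mulX K n q) i l = fracDigits Y q i (l + 1) := by
  have e : ∑ j, Y i j * polyIncl (X * q j) = LaurentInv.X ^ 1 * ∑ j, Y i j * polyIncl (q j) := by
    rw [Finset.mul_sum]
    refine Finset.sum_congr rfl fun j _ => ?_
    rw [polyIncl_X_mul]
    ring
  simp only [fracDigits_apply, mulX_apply, e, lcoeff_X_pow_mul]
  push_cast
  rfl

/-- The space of the `q` of degree `< A` for which the first `M - A` digits of `Yq` vanish. -/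
noncomputable def smallDigits {m n : ℕ} (Y : FMat K m n) (M A : ℕ) :
    Submodule K (Fin n → K[X]) where
  carrier := {q | (∀ j, ∀ k ≥ A, (q j).coeff k = 0) ∧ ∀ i l, l + A < M → fracDigits Y q i l = 0}
  zero_mem' := by simp
  add_mem' := by
    rintro q q' ⟨h1, h2⟩ ⟨h1', h2'⟩
    refine ⟨fun j k hk => ?_, fun i l hl => ?_⟩
    · simp [h1 j k hk, h1' j k hk]
    · simp [h2 i l hl, h2' i l hl]
  smul_mem' := by
    rintro a q ⟨h1, h2⟩
    refine ⟨fun j k hk => ?_, fun i l hl => ?_⟩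
    · simp [h1 j k hk]
    · simp [h2 i l hl]

theorem mem_smallDigits {m n : ℕ} {Y : FMat K m n} {M A : ℕ} {q : Fin n → K[X]} :
    q ∈ smallDigits Y M A ↔
      (∀ j, ∀ k ≥ A, (q j).coeff k = 0) ∧ ∀ i l, l + A < M → fracDigits Y q i l = 0 := Iff.rfl

/-- The inclusion of the vectors of polynomials of degree `< A`. -/
noncomputable def inclDegreeLT (K : Type*) [Field K] (n A : ℕ) :
    (Fin n → degreeLT K A) →ₗ[K] (Fin n → K[X]) :=
  LinearMap.pi fun j => (degreeLT K A).subtype ∘ₗ LinearMap.proj j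

theorem inclDegreeLT_injective (n A : ℕ) : Function.Injective (inclDegreeLT K n A) := by
  intro q q' h
  ext1 j
  exact Subtype.ext (congrFun h j)

/-- The first `B` digits of `Yq`, for `q` of degree `< A`. -/
noncomputable def truncDigits {m n : ℕ} (Y : FMat K m n) (A B : ℕ) :
    (Fin n → degreeLT K A) →ₗ[K] (Fin m → Fin B → K) :=
  LinearMap.pi (fun i => LinearMap.pi fun l : Fin B =>
    LinearMap.proj (l : ℕ) ∘ₗ LinearMap.proj i) ∘ₗ fracDigits Y ∘ₗ inclDegreeLT K n A

instance finiteDimensional_degreeLT (A : ℕ) : FiniteDimensional K (degreeLT K A) :=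
  Module.Finite.equiv (degreeLTEquiv K A).symm

theorem smallDigits_eq_map {m n : ℕ} (Y : FMat K m n) (M A : ℕ) :
    smallDigits Y M A = (truncDigits Y A (M - A)).ker.map (inclDegreeLT K n A) := by
  ext q
  rw [mem_smallDigits, Submodule.mem_map]
  constructor
  · rintro ⟨h1, h2⟩
    refine ⟨fun j => ⟨q j, mem_degreeLT.mpr ((degree_lt_iff_coeff_zero _ _).mpr (h1 j))⟩, ?_, rfl⟩
    rw [LinearMap.mem_ker]
    ext i l
    exact h2 i l (by omega)
  · rintro ⟨q, hq, rfl⟩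
    refine ⟨fun j k hk => ?_, fun i l hl => ?_⟩
    · exact (degree_lt_iff_coeff_zero _ _).mp (mem_degreeLT.mp (q j).2) k hk
    · exact congrFun (congrFun (LinearMap.mem_ker.mp hq) i) ⟨l, by omega⟩

instance finiteDimensional_smallDigits {m n : ℕ} (Y : FMat K m n) (M A : ℕ) :
    FiniteDimensional K (smallDigits Y M A) := by
  rw [smallDigits_eq_map]
  infer_instance

theorem finrank_range_truncDigits_add {m n : ℕ} (Y : FMat K m n) (M A : ℕ) :
    Module.finrank K (truncDigits Y A (M - A)).range + Module.finrank K (smallDigits Y M A) =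
      n * A := by
  have h1 := LinearMap.finrank_range_add_finrank_ker (truncDigits Y A (M - A))
  have h2 : Module.finrank K (smallDigits Y M A) =
      Module.finrank K (truncDigits Y A (M - A)).ker := by
    rw [smallDigits_eq_map]
    exact (Submodule.equivMapOfInjective _ (inclDegreeLT_injective n A) _).finrank_eq.symm
  rw [h2, h1, Module.finrank_pi_fintype]
  simp [(degreeLTEquiv K A).finrank_eq]

/-- Write `W` for `smallDigits Y M`. Multiplication by `X` raises degrees and shifts digits by one,
so `W (A + 1)` and `X W (A + 1)` both lie in `W (A + 2)` and meet inside `X W A`. The dimension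
formula for sum and intersection concludes. -/
theorem finrank_smallDigits_convex {m n : ℕ} (Y : FMat K m n) {M A : ℕ} (hA : A + 2 ≤ M) :
    2 * Module.finrank K (smallDigits Y M (A + 1)) ≤
      Module.finrank K (smallDigits Y M A) + Module.finrank K (smallDigits Y M (A + 2)) := by
  set W := smallDigits Y M
  have hfr : ∀ V : Submodule K (Fin n → K[X]),
      Module.finrank K (V.map (mulX K n)) = Module.finrank K V := fun V =>
    (Submodule.equivMapOfInjective _ (mulX_injective n) V).finrank_eq.symm
  have hsup : (W (A + 1)).map (mulX K n) ⊔ W (A + 1) ≤ W (A + 2) := by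
    refine sup_le ?_ ?_
    · rintro _ ⟨q, ⟨h1, h2⟩, rfl⟩
      refine ⟨fun j k hk => ?_, fun i l hl => ?_⟩
      · obtain ⟨k, rfl⟩ : ∃ k', k = k' + 1 := ⟨k - 1, by omega⟩
        rw [mulX_apply, coeff_X_mul]
        exact h1 j k (by omega)
      · rw [fracDigits_mulX]
        exact h2 i _ (by omega)
    · rintro q ⟨h1, h2⟩
      exact ⟨fun j k hk => h1 j k (by omega), fun i l hl => h2 i l (by omega)⟩
  have hinf : (W (A + 1)).map (mulX K n) ⊓ W (A + 1) ≤ (W A).map (mulX K n) := by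
    rintro _ ⟨⟨q, ⟨h1, h2⟩, rfl⟩, ⟨h3, h4⟩⟩
    refine ⟨q, ⟨fun j k hk => ?_, fun i l hl => ?_⟩, rfl⟩
    · have := h3 j (k + 1) (by omega)
      rwa [mulX_apply, coeff_X_mul] at this
    -- The digit `l = 0` of `q` is lost in `X q`; it vanishes because `q` itself lies in `W (A + 1)`
    -- and `A + 2 ≤ M`.
    · rcases l with _ | l
      · exact h2 i 0 (by omega)
      · rw [← fracDigits_mulX]
        exact h4 i l (by omega)
  have h := Submodule.finrank_sup_add_finrank_inf_eq ((W (A + 1)).map (mulX K n)) (W (A + 1))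
  have h1 := Submodule.finrank_mono hsup
  have h2 := Submodule.finrank_mono hinf
  rw [hfr] at h h2
  omega

/-- A convex sequence that is positive at `A` and vanishes at `M ≥ A` decreases up to `A`. -/
theorem add_le_of_convex_of_pos {g : ℕ → ℤ} {M A : ℕ} (hA : A ≤ M)
    (hg : ∀ a, a + 2 ≤ M → 2 * g (a + 1) ≤ g a + g (a + 2)) (hM : g M = 0) (hpos : 0 < g A) (k : ℕ)
    (hk : k ≤ A) : g A + k ≤ g (A - k) := by
  have step : ∀ a, a < A → g (a + 1) + 1 ≤ g a := by
    intro a ha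
    -- Without a drop after `a`, convexity keeps `g` nondecreasing up to `M`, so `g A ≤ g M = 0`.
    by_contra hlt
    push Not at hlt
    have hmono : ∀ b, a + b < M → g (a + b) ≤ g (a + b + 1) := by
      intro b
      induction b with
      | zero => intro _; simp only [add_zero]; omega
      | succ b ih =>
        intro hb
        have h1 := ih (by omega)
        have h2 := hg (a + b) (by omega)
        have e : a + (b + 1) = a + b + 1 := by ring
        rw [e]
        have e2 : a + b + 1 + 1 = a + b + 2 := by ring
        rw [e2]
        omega
    have hge : ∀ c, A + c ≤ M → g A ≤ g (A + c) := by
      intro c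
      induction c with
      | zero => intro _; simp
      | succ c ih =>
        intro hc
        have h1 := ih (by omega)
        have h2 := hmono (A + c - a) (by omega)
        rw [show a + (A + c - a) = A + c by omega] at h2
        exact h1.trans h2
    have := hge (M - A) (by omega)
    rw [show A + (M - A) = M by omega] at this
    omega
  induction k with
  | zero => simp
  | succ k ih =>
    have h1 := ih (by omega)
    have h2 := step (A - (k + 1)) (by omega)
    rw [show A - (k + 1) + 1 = A - k by omega] at h2
    push_cast
    omega

/-- If no nonzero `q` is small at a suitable earlier stage, then every choice of digits occurs. -/
theorem truncDigits_surjective {m n : ℕ} (Y : FMat K m n) {A B k : ℕ} (hk : k ≤ A)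
    (h0 : smallDigits Y (A + B) (A - k) = ⊥) (h : m * B + (m + n) * k ≤ n * A + k) :
    Function.Surjective (truncDigits Y A B) := by
  set M := A + B with hM
  have hB : M - A = B := by omega
  -- By rank–nullity, for `a ≤ M` this is the codimension of the range of `truncDigits Y a (M - a)`.
  set g : ℕ → ℤ := fun a => m * ((M : ℤ) - a) - n * a + Module.finrank K (smallDigits Y M a) with hg
  have hfr : ∀ a, (Module.finrank K (truncDigits Y a (M - a)).range : ℤ) +
      Module.finrank K (smallDigits Y M a) = n * a := fun a => by
    exact_mod_cast finrank_range_truncDigits_add Y M a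
  rw [← LinearMap.range_eq_top]
  by_contra hne
  have hlt := Submodule.finrank_lt hne
  rw [Module.finrank_pi_fintype] at hlt
  simp only [Module.finrank_fin_fun, Finset.sum_const, Finset.card_univ, Fintype.card_fin,
    smul_eq_mul] at hlt
  have hlt' : (Module.finrank K (truncDigits Y A B).range : ℤ) < m * B := by exact_mod_cast hlt
  have hfA := hfr A
  rw [hB] at hfA
  have hMB : (M : ℤ) - A = B := by rw [hM]; push_cast; ring
  have hpos : 0 < g A := by
    simp only [hg, hMB]
    linarith
  have hgM : g M = 0 := by
    have h1 := hfr M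
    have h2 : Module.finrank K (truncDigits Y M (M - M)).range = 0 := by
      have h3 := Submodule.finrank_le (truncDigits Y M (M - M)).range
      rw [Module.finrank_pi_fintype] at h3
      simpa using h3
    rw [h2] at h1
    simp only [hg]
    push_cast at h1
    linarith
  have hconv : ∀ a, a + 2 ≤ M → 2 * g (a + 1) ≤ g a + g (a + 2) := by
    intro a ha
    have h1 : (2 * Module.finrank K (smallDigits Y M (a + 1)) : ℤ) ≤
      Module.finrank K (smallDigits Y M a) + Module.finrank K (smallDigits Y M (a + 2)) := by
      exact_mod_cast finrank_smallDigits_convex Y ha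
    simp only [hg]
    push_cast
    linarith
  -- Thus `g (A - k) ≥ k + 1`, whereas `h0` and `h` give `g (A - k) ≤ k`.
  have key := add_le_of_convex_of_pos (by omega) hconv hgM hpos k hk
  have hgk : g (A - k) = m * B + (m + n) * k - n * A := by
    have h0' : Module.finrank K (smallDigits Y M (A - k)) = 0 := by
      rw [h0]
      exact finrank_bot K _
    simp only [hg, h0']
    push_cast [hk]
    rw [hM]
    push_cast
    ring
  have h' : (m * B + (m + n) * k : ℤ) ≤ n * A + k := by exact_mod_cast h
  linarith

/-- Dirichlet's argument: fewer linear conditions than coefficients. -/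
theorem smallDigits_ne_bot {m n : ℕ} (Y : FMat K m n) {A B : ℕ} (h : m * B < n * A) :
    smallDigits Y (A + B) A ≠ ⊥ := by
  intro h0
  have h1 := finrank_range_truncDigits_add Y (A + B) A
  rw [h0, finrank_bot, add_zero, show A + B - A = B by omega] at h1
  have h2 := Submodule.finrank_le (truncDigits Y A B).range
  rw [Module.finrank_pi_fintype] at h2
  simp only [Module.finrank_fin_fun, Finset.sum_const, Finset.card_univ, Fintype.card_fin,
    smul_eq_mul] at h2
  omega

theorem norm_polyVec_pow_lt {n : ℕ} (hn : n ≠ 0) {A : ℕ} {q : Fin n → K[X]}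
    (hq : ∀ j, ∀ k ≥ A, (q j).coeff k = 0) : ‖polyVec q‖ ^ n < Real.exp (n * A) := by
  rw [Real.exp_nat_mul]
  refine pow_lt_pow_left₀ ((pi_norm_lt_iff (Real.exp_pos _)).mpr fun j => ?_) (norm_nonneg _) hn
  have e : (A : ℝ) = -((-(A : ℤ) : ℤ) : ℝ) := by push_cast; ring
  rw [e, norm_lt_exp_iff]
  intro k hk
  obtain ⟨l, rfl⟩ : ∃ l : ℕ, k = -(l : ℤ) := ⟨(-k).toNat, by omega⟩
  exact (lcoeff_polyIncl _ _).trans (hq j l (by omega))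

/-- The choice of `p` cancels the digits of index at most 0; the next `B` vanish by hypothesis. -/
theorem exists_norm_affineForm_pow_lt {m n : ℕ} (hm : m ≠ 0) (Y : FMat K m n)
    (θ : Fin m → LaurentInv K) {B : ℕ} {q : Fin n → K[X]}
    (h : ∀ i, ∀ l < B, fracDigits Y q i l + lcoeff (l + 1) (θ i) = 0) :
    ∃ p, ‖affineForm Y (polyVec q) (polyVec p + θ)‖ ^ m < Real.exp (-(m * B)) := by
  choose p hp using fun i => exists_polynomial_norm_add_lt_one
    (∑ j, Y i j * polyIncl (q j) + θ i)
  refine ⟨p, ?_⟩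
  rw [← mul_neg, Real.exp_nat_mul]
  refine pow_lt_pow_left₀ ((pi_norm_lt_iff (Real.exp_pos _)).mpr fun i => ?_) (norm_nonneg _) hm
  have e : affineForm Y (polyVec q) (polyVec p + θ) i =
      polyIncl (p i) + (∑ j, Y i j * polyIncl (q j) + θ i) := by
    simp only [affineForm, Pi.add_apply, polyVec]
    ring
  have h1 : ‖polyIncl (p i) + (∑ j, Y i j * polyIncl (q j) + θ i)‖ <
      Real.exp (-((0 : ℤ) : ℝ)) := by simpa using hp i
  rw [norm_lt_exp_iff] at h1
  rw [e, ← Int.cast_natCast, norm_lt_exp_iff]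
  intro k hk
  rcases le_or_gt k 0 with hk0 | hk0
  · exact h1 k hk0
  · obtain ⟨l, rfl⟩ : ∃ l : ℕ, k = (l : ℤ) + 1 := ⟨(k - 1).toNat, by omega⟩
    have h2 := h i l (by omega)
    rw [fracDigits_apply] at h2
    rw [map_add, map_add, lcoeff_polyIncl_pos _ (by omega), h2, add_zero]

theorem mem_expoSet_of_lt_one {m n : ℕ} (hm : 0 < m) (hn : 0 < n) {Y : FMat K m n}
    (hY : expo Y 0 ≤ 1) (θ : Fin m → LaurentInv K) {w : ℝ} (hw0 : 0 ≤ w) (hw1 : w < 1) :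
    w ∈ expoSet Y θ := by
  refine ⟨hw0, fun T₀ => ?_⟩
  obtain ⟨Q, hQ⟩ := exists_nat_gt (max 2 ((m + n) / (1 - w)))
  have hQ2 : (2 : ℝ) < Q := (le_max_left _ _).trans_lt hQ
  have hQ2' : 2 < Q := by exact_mod_cast hQ2
  have hQw : (m + n : ℝ) < Q * (1 - w) :=
    (div_lt_iff₀ (by linarith)).mp ((le_max_right _ _).trans_lt hQ)
  have hnR : (1 : ℝ) ≤ n := by exact_mod_cast hn
  have hmR : (1 : ℝ) ≤ m := by exact_mod_cast hm
  have hnot : 1 + 1 / (n * Q : ℝ) ∉ expoSet Y 0 := fun h => by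
    have h1 := expo_le_one_iff.mp hY _ h
    have h2 : 0 < 1 / (n * Q : ℝ) := by positivity
    linarith
  obtain ⟨T₁, hT₁⟩ : ∃ T₁ : ℝ, ∀ T, T₁ ≤ T → 1 ≤ T → ∀ (p : Fin m → K[X]) (q : Fin n → K[X]),
      q ≠ 0 → ‖affineForm Y (polyVec q) (polyVec p + 0)‖ ^ m <
        Real.exp (-(1 + 1 / (n * Q : ℝ)) * T) → ¬ ‖polyVec q‖ ^ n < Real.exp T := by
    by_contra hcon
    push Not at hcon
    exact hnot ⟨by positivity, hcon⟩
  obtain ⟨u, hu⟩ := exists_nat_gt (max T₀ (max (T₁ + m) ((m + n) * m + m + 1)))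
  have hu0 : T₀ < u := (le_max_left _ _).trans_lt hu
  have hu1 : T₁ + m < u := ((le_max_left _ _).trans (le_max_right _ _)).trans_lt hu
  have hu2R : ((m + n) * m + m + 1 : ℝ) < u :=
    ((le_max_right _ _).trans (le_max_right _ _)).trans_lt hu
  have hu2 : (m + n) * m + m + 1 < u := by exact_mod_cast hu2R
  -- With these choices and `B` as large as surjectivity allows, a nonzero `q` in `smallDigits Y (A
  -- + B) (A - k)` has `m(B + k) > n(A - k) + u`. The excess `u` is at least the proportion `1/(nQ)`
  -- of `n(A - k)`, which contradicts `ω(Y, 0) ≤ 1`. The final loss `(m + n)u` stays below `(1 -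
  -- w)nA` by the choice of `Q`.
  obtain ⟨A, hA⟩ : ∃ A, A = Q * u := ⟨_, rfl⟩
  obtain ⟨k, hk⟩ : ∃ k, k = u + m := ⟨_, rfl⟩
  have hAu : 3 * u ≤ A := by rw [hA]; exact Nat.mul_le_mul_right u hQ2'
  have hkA : k ≤ A := by nlinarith
  have hAR : (A : ℝ) = Q * u := by rw [hA]; push_cast; ring
  have hkR : (k : ℝ) = u + m := by rw [hk]; push_cast; ring
  have huR : (0 : ℝ) < u := by exact_mod_cast (Nat.zero_le _).trans_lt hu2
  have hloss : (m + n : ℝ) * u ≤ (1 - w) * (n * A) := by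
    rw [hAR]
    have h1 : (m + n : ℝ) * u ≤ Q * (1 - w) * u := by gcongr
    have h2 : Q * (1 - w) * u ≤ n * (Q * (1 - w) * u) :=
      le_mul_of_one_le_left (mul_nonneg (mul_nonneg (by positivity) (by linarith)) huR.le) hnR
    linarith
  obtain ⟨B, hB1, hB2⟩ : ∃ B, m * B + (m + n) * k ≤ n * A + k ∧
      n * A + k < m * B + m + (m + n) * k := by
    have hle : (m + n) * k ≤ n * A + k := by
      have h1 : (m + n : ℝ) * k ≤ n * A + k := by
        have h2 : 0 ≤ w * (n * A : ℝ) := by positivity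
        rw [hkR]
        nlinarith
      exact_mod_cast h1
    refine ⟨(n * A + k - (m + n) * k) / m, ?_, ?_⟩
    · have := Nat.mul_div_le (n * A + k - (m + n) * k) m
      omega
    · have := Nat.lt_mul_div_succ (n * A + k - (m + n) * k) hm
      rw [Nat.mul_add, mul_one] at this
      omega
  have hB2R : (n * A + k : ℝ) < m * B + m + (m + n) * k := by exact_mod_cast hB2
  have hker : smallDigits Y (A + B) (A - k) = ⊥ := by
    rw [Submodule.eq_bot_iff]
    rintro q ⟨hq1, hq2⟩
    by_contra hq0
    obtain ⟨p, hp⟩ := exists_norm_affineForm_pow_lt hm.ne' Y 0 (B := B + k) (q := q)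
      fun i l hl => by rw [hq2 i l (by omega), Pi.zero_apply, map_zero, add_zero]
    have hcast : ((A - k : ℕ) : ℝ) = A - k := by push_cast [hkA]; ring
    have hAk : (u : ℝ) - m ≤ A - k := by
      have : (3 * u : ℝ) ≤ A := by exact_mod_cast hAu
      linarith
    have hmn : (0 : ℝ) ≤ (m + n) * m := by positivity
    have hAkn : (A : ℝ) - k ≤ n * (A - k) := le_mul_of_one_le_left (by linarith) hnR
    refine hT₁ (n * (A - k : ℕ)) ?_ ?_ p q hq0 (hp.trans_le (Real.exp_le_exp.mpr ?_))
      (norm_polyVec_pow_lt hn.ne' hq1)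
    · rw [hcast]; linarith
    · rw [hcast]; linarith
    · rw [hcast]
      have h1 : (1 + 1 / (n * Q : ℝ)) * (n * (A - k)) = n * (A - k) + (A - k) / Q := by
        field_simp
      have h2 : (A - k : ℝ) / Q ≤ u := by
        rw [div_le_iff₀ (by linarith), hAR]
        have : (0 : ℝ) ≤ k := by positivity
        linarith
      rw [neg_mul, h1, neg_le_neg_iff]
      push_cast
      linarith
  have hBA : m * B < n * A := by
    have h1 : 2 * k ≤ (m + n) * k := Nat.mul_le_mul_right k (by omega)
    have : 0 < k := by omega
    omega
  obtain ⟨q₀, hq₀, hq₀0⟩ := Submodule.exists_mem_ne_zero_of_ne_bot (smallDigits_ne_bot Y hBA)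
  obtain ⟨q₁, hq₁⟩ := truncDigits_surjective Y hkA hker hB1
    fun i l => -lcoeff ((l : ℕ) + 1) (θ i)
  have hq₁' : ∀ i, ∀ l < B, fracDigits Y (inclDegreeLT K n A q₁) i l = -lcoeff (l + 1) (θ i) :=
    fun i l hl => congrFun (congrFun hq₁ i) ⟨l, hl⟩
  -- The preimage of the digits of `-θ` may be 0, namely when they all vanish; then the nonzero
  -- homogeneous solution `q₀` serves.
  obtain ⟨q, hq0, hqA, hqd⟩ : ∃ q : Fin n → K[X], q ≠ 0 ∧ (∀ j, ∀ k ≥ A, (q j).coeff k = 0) ∧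
      ∀ i, ∀ l < B, fracDigits Y q i l + lcoeff (l + 1) (θ i) = 0 := by
    by_cases h : inclDegreeLT K n A q₁ = 0
    · refine ⟨q₀, hq₀0, hq₀.1, fun i l hl => ?_⟩
      have h1 := hq₁' i l hl
      rw [h, map_zero] at h1
      rw [hq₀.2 i l (by omega)]
      simpa [eq_comm] using h1
    · refine ⟨_, h, fun j k hk => ?_, fun i l hl => ?_⟩
      · exact (degree_lt_iff_coeff_zero _ _).mp (mem_degreeLT.mp (q₁ j).2) k hk
      · rw [hq₁' i l hl, neg_add_cancel]
  obtain ⟨p, hp⟩ := exists_norm_affineForm_pow_lt hm.ne' Y θ hqd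
  have hnA : (u : ℝ) ≤ n * A := by
    have h1 : (3 * u : ℝ) ≤ A := by exact_mod_cast hAu
    have h2 : (A : ℝ) ≤ n * A := le_mul_of_one_le_left (by positivity) hnR
    linarith
  refine ⟨n * A, by linarith, ?_, p, q, hq0, hp.trans_le (Real.exp_le_exp.mpr ?_),
    norm_polyVec_pow_lt hn.ne' hqA⟩
  · have hmn : (0 : ℝ) ≤ (m + n) * m := by positivity
    linarith
  · rw [neg_mul, neg_le_neg_iff]
    rw [hkR] at hB2R
    nlinarith

/-! ### Comparison of the exponents and passage from local to global -/

theorem one_le_sSup_of_forall_mem {W : Set ℝ} (h : ∀ w, 0 ≤ w → w < 1 → w ∈ W) :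
    1 ≤ sSup (Real.toEReal '' W) := by
  by_contra hlt
  push Not at hlt
  obtain ⟨r, hr1, hr2⟩ := EReal.lt_iff_exists_real_btwn.mp hlt
  have hr : r < 1 := by exact_mod_cast hr2
  have h1 : ((max r 0 : ℝ) : EReal) ≤ sSup (Real.toEReal '' W) :=
    le_sSup ⟨_, h _ (le_max_right _ _) (max_lt hr one_pos), rfl⟩
  have h2 : (r : EReal) ≤ ((max r 0 : ℝ) : EReal) := EReal.coe_le_coe_iff.mpr (le_max_left _ _)
  exact absurd (h2.trans h1) (not_le.mpr hr1)

theorem one_le_expo {m n : ℕ} (hm : 0 < m) (hn : 0 < n) {Y : FMat K m n} (hY : expo Y 0 ≤ 1)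
    (θ : Fin m → LaurentInv K) : 1 ≤ expo Y θ :=
  one_le_sSup_of_forall_mem fun _ => mem_expoSet_of_lt_one hm hn hY θ

/-- Each factor is at most the norm; for `max 1 ‖q j‖` this uses that a nonzero polynomial vector
has norm at least 1. -/
theorem expo_le_mulExpo {m n : ℕ} (Y : FMat K m n) (θ : Fin m → LaurentInv K) :
    expo Y θ ≤ mulExpo Y θ := by
  refine sSup_le_sSup (Set.image_mono ?_)
  rintro w ⟨hw0, hw⟩
  refine ⟨hw0, fun T₀ => ?_⟩
  obtain ⟨T, hT, hT1, p, q, hq0, hp, hq⟩ := hw T₀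
  refine ⟨T, hT, hT1, p, q, hq0, lt_of_le_of_lt ?_ hp, lt_of_le_of_lt ?_ hq⟩
  · refine (Finset.prod_le_prod (fun _ _ => norm_nonneg _)
      fun i _ => norm_le_pi_norm (affineForm Y (polyVec q) (polyVec p + θ)) i).trans ?_
    simp
  · obtain ⟨l, hl, hl1⟩ := exists_norm_polyVec_eq hq0
    refine (Finset.prod_le_prod (fun _ _ => by positivity)
      fun j _ => max_le (hl1.trans_eq hl.symm) (norm_le_pi_norm (polyVec q) j)).trans ?_
    simp

/-- A property that holds almost everywhere on a neighbourhood of almost every point holds almost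
everywhere. -/
theorem ae_of_ae_nhds_restrict {X : Type*} [TopologicalSpace X] [SecondCountableTopology X]
    [MeasurableSpace X] {μ : Measure X} {P : X → Prop}
    (h : ∀ᵐ x ∂μ, ∃ V ∈ 𝓝 x, MeasurableSet V ∧ ∀ᵐ y ∂μ.restrict V, P y) : ∀ᵐ x ∂μ, P x := by
  have h1 : μ {x | ¬ P x ∧ ∃ V ∈ 𝓝 x, MeasurableSet V ∧ ∀ᵐ y ∂μ.restrict V, P y} = 0 := by
    refine measure_null_of_locally_null _ fun x hx => ?_
    obtain ⟨-, V, hV, hVm, hVP⟩ := hx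
    refine ⟨_, inter_mem_nhdsWithin _ hV, ?_⟩
    rw [ae_restrict_iff' hVm, ae_iff] at hVP
    refine measure_mono_null ?_ hVP
    rintro y ⟨⟨hy, -⟩, hyV⟩
    exact fun h => hy (h hyV)
  have h2 : ∀ᵐ x ∂μ, ¬ (¬ P x ∧ ∃ V ∈ 𝓝 x, MeasurableSet V ∧ ∀ᵐ y ∂μ.restrict V, P y) := by
    rw [ae_iff]
    simpa only [not_not] using h1
  filter_upwards [h, h2] with x hx hx2
  by_contra hP
  exact hx2 ⟨hP, hx⟩

end FunctionFieldDA

theorem theorem2p1 {K : Type*} [Field K] [Finite K] (m n : ℕ) (hm : 0 < m) (hn : 0 < n)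
    (μ : MeasureTheory.Measure (FunctionFieldDA.FMat K m n)) :
    (FunctionFieldDA.ContractingAE μ →
      (FunctionFieldDA.Extremal μ ↔ FunctionFieldDA.InhomExtremal μ)) ∧
    (FunctionFieldDA.StronglyContractingAE μ →
      (FunctionFieldDA.StronglyExtremal μ ↔ FunctionFieldDA.InhomStronglyExtremal μ)) := by
  refine ⟨fun hμ => ⟨fun h θ => ?_, fun h => h 0⟩, fun hμ => ⟨fun h θ => ?_, fun h => h 0⟩⟩
  · have hle : ∀ᵐ Y ∂μ, FunctionFieldDA.expo Y θ ≤ 1 := by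
      refine FunctionFieldDA.ae_of_ae_nhds_restrict (hμ.mono ?_)
      rintro Y₀ ⟨V, hV, hVm, hVc⟩
      exact ⟨V, hV, hVm, hVc.ae_expo_le_one hm hn
        (ae_restrict_of_ae (h.mono fun _ hY => le_of_eq hY)) θ⟩
    filter_upwards [h, hle] with Y h1 h2
    exact le_antisymm h2 (FunctionFieldDA.one_le_expo hm hn h1.le θ)
  · have hle : ∀ᵐ Y ∂μ, FunctionFieldDA.mulExpo Y θ ≤ 1 := by
      refine FunctionFieldDA.ae_of_ae_nhds_restrict (hμ.mono ?_)
      rintro Y₀ ⟨V, hV, hVm, hVc⟩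
      exact ⟨V, hV, hVm, hVc.ae_mulExpo_le_one hm
        (ae_restrict_of_ae (h.mono fun _ hY => le_of_eq hY)) θ⟩
    filter_upwards [h, hle] with Y h1 h2
    refine le_antisymm h2 (le_trans ?_ (FunctionFieldDA.expo_le_mulExpo Y θ))
    exact FunctionFieldDA.one_le_expo hm hn ((FunctionFieldDA.expo_le_mulExpo Y 0).trans h1.le) θ
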